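/- **Definitions.** A *cofinality spectrum problem* (CSP) $\mathbf s=(M,N,M^+,N^+,\Delta)$ consists of structures $M,N$ in a first-order language $L$, expansions $M^+,N^+$ of them to a language $L^+\supseteq L$ with $M^+\preceq N^+$ (so $M\preceq N$), and a set $\Delta$ of partitioned $L$-formulas $\varphi(\bar x,\bar y;\bar z)$ with $\ell(\bar x)=\ell(\bar y)$, together with the following data. "Definable" means definable in $N^+$ with parameters. 1. *Orders.* $\mathrm{Or}(\mathbf s)$ is a set of tuples $\mathbf a=(X_{\mathbf a},\le_{\mathbf a},\varphi_{\mathbf a},\bar c_{\mathbf a},d_{\mathbf a})$, where $\varphi_{\mathbf a}\in\Delta$, $\bar c_{\mathbf a}$ is a tuple from $N$, $X_{\mathbf a}=\{\bar a: N\models\varphi_{\mathbf a}(\bar a,\bar a;\bar c_{\mathbf a})\}$, $\bar x\le_{\mathbf a}\bar y$ means $N\models\varphi_{\mathbf a}(\bar x,\bar y;\bar c_{\mathbf a})$, and $d_{\mathbf a}\in X_{\mathbf a}$ is a designated element. For every $\varphi\in\Delta$ and every $\bar c$ from $N$ for which $\{\bar a:N\models\varphi(\bar a,\bar a;\bar c)\}$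 is nonempty, some $\mathbf a\in\mathrm{Or}(\mathbf s)$ has $\varphi_{\mathbf a}=\varphi$ and $\bar c_{\mathbf a}=\bar c$. Each $(X_{\mathbf a},\le_{\mathbf a})$ is a discrete linear order with a least element $0_{\mathbf a}$, and is pseudofinite: every bounded nonempty definable subset has a least and a greatest element. Call $\mathbf a$ *nontrivial* if $d_{\mathbf a}$ is not a finite successor of $0_{\mathbf a}$ (that is, not obtained from $0_{\mathbf a}$ by finitely many, possibly zero, successor steps). 2. *Products.* For all $\mathbf a,\mathbf b\in\mathrm{Or}(\mathbf s)$ there is $\mathbf c\in\mathrm{Or}(\mathbf s)$ with a definable bijection $X_{\mathbf a}\times X_{\mathbf b}\to X_{\mathbf c}$, and such that $\mathbf c$ is nontrivial if both $\mathbf a$ and $\mathbf b$ are. For at least one nontrivial $\mathbf a$ there are $\mathbf c\in\mathrm{Or}(\mathbf s)$ and a definable bijection $\mathrm{Pr}:X_{\mathbf a}\times X_{\mathbf a}\to X_{\mathbf c}$ such that for each $x\in X_{\mathbf a}$ there is $y\in X_{\mathbf c}$ with: for all $x_1,x_2\in X_{\mathbf a}$, $\max\{x_1,x_2\}\le_{\mathbf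 a}x$ if and only if $\mathrm{Pr}(x_1,x_2)\le_{\mathbf c}y$. 3. *Trees.* Each $\mathbf a\in\mathrm{Or}(\mathbf s)$ has an associated tree $(\mathcal T_{\mathbf a},\trianglelefteq_{\mathbf a})$. It is given by $L^+$-formulas that depend only on $\varphi_{\mathbf a}$, evaluated at the parameters $\bar c_{\mathbf a},d_{\mathbf a}$, which define its set of nodes, $\trianglelefteq_{\mathbf a}$, the length function and the evaluation function. The nodes are (coded as tuples from $N$) functions $b$ from a set $\{n: n<_{\mathbf a}\mathrm{lgn}(b)\}$ to $X_{\mathbf a}$, with $\mathrm{lgn}(b)\in X_{\mathbf a}$ and $\mathrm{lgn}(b)\le_{\mathbf a}d_{\mathbf a}$; $\trianglelefteq_{\mathbf a}$ is the relation of being an initial segment; the empty function is a node; and if $b$ is a node with $\mathrm{lgn}(b)<_{\mathbf a}d_{\mathbf a}$, then $b^\smallfrown\langle x\rangle$ is a node for every $x\in X_{\mathbf a}$. A *$(\kappa_1,\kappa_2)$-cut* in a linear order consists of a strictly increasing sequence $\langle a_\alpha:\alpha<\kappa_1\rangle$ and a strictly decreasing sequence $\langle b_\beta:\beta<\kappa_2\rangle$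 such that $a_\alpha<b_\beta$ for all $\alpha,\beta$ and no $x$ satisfies $a_\alpha<x<b_\beta$ for all $\alpha,\beta$. Regular cardinals are infinite by convention. Let $\mathscr C(\mathbf s)$ be the set of pairs $(\kappa_1,\kappa_2)$ of regular cardinals such that $X_{\mathbf a}$ has a $(\kappa_1,\kappa_2)$-cut for some nontrivial $\mathbf a\in\mathrm{Or}(\mathbf s)$. Let $\mathfrak p_{\mathbf s}$ be the minimum of $\kappa_1+\kappa_2$ over $(\kappa_1,\kappa_2)\in\mathscr C(\mathbf s)$. Let $\mathfrak t_{\mathbf s}$ be the minimum $\kappa$ such that in some tree $\mathcal T_{\mathbf a}$, $\mathbf a\in\mathrm{Or}(\mathbf s)$, there is a strictly $\trianglelefteq_{\mathbf a}$-increasing $\kappa$-indexed sequence with no upper bound. (The minimum of the empty set is $\infty$, and $\infty^+=\infty$.) **Lemma (Uniqueness).** Let $\mathbf s$ be a cofinality spectrum problem and let $\kappa$ be a regular cardinal with $\kappa<\min\{\mathfrak p_{\mathbf s}^+,\mathfrak t_{\mathbf s}\}$. Then there is one and only one $\theta$ such that $(\kappa,\theta)\in\mathscr C(\mathbf s)$.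 Moreover, for every $\theta$, $(\kappa,\theta)\in\mathscr C(\mathbf s)$ if and only if $(\theta,\kappa)\in\mathscr C(\mathbf s)$. -/

import Mathlib

namespace CofinalitySpectrum

open FirstOrder

universe u u' v w v' w'

/-! ### Definable orders -/

/-- A partitioned formula `φ(x̄, ȳ; z̄)` with `ℓ(x̄) = ℓ(ȳ)`. -/
structure OrderFormula (L : FirstOrder.Language.{v, w}) where
  arity : ℕ
  params : ℕ
  formula : L.Formula (Fin arity ⊕ Fin arity ⊕ Fin params)

/-- The set `X = {ā : N ⊨ φ(ā, ā; c̄)}`. -/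
def OrderFormula.Carrier {L : FirstOrder.Language.{v, w}} {N : Type u} [L.Structure N]
    (φ : OrderFormula L) (c : Fin φ.params → N) : Set (Fin φ.arity → N) :=
  {x | φ.formula.Realize (Sum.elim x (Sum.elim x c))}

/-- An order with a designated element: a formula `φ`, a parameter tuple `c̄` from `N`, and an
element `d` of the set `X` defined by `φ(x̄, x̄; c̄)`. -/
structure OrderDatum (L : FirstOrder.Language.{v, w}) (N : Type u) [L.Structure N] where
  φ : OrderFormula L
  c : Fin φ.params → N
  d : φ.Carrier c

namespace OrderDatum

variable {L : FirstOrder.Language.{v, w}} {N : Type u} [L.Structure N]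

/-- The underlying set `X_a`, as a set of tuples from `N`. -/
abbrev X (a : OrderDatum L N) : Set (Fin a.φ.arity → N) := a.φ.Carrier a.c

/-- The relation `x ≤_a y`, that is `N ⊨ φ_a(x, y; c_a)`. -/
def le (a : OrderDatum L N) (x y : a.X) : Prop :=
  a.φ.formula.Realize (Sum.elim x.1 (Sum.elim y.1 a.c))

/-- The strict relation `x <_a y`. -/
def lt (a : OrderDatum L N) (x y : a.X) : Prop := a.le x y ∧ x ≠ y

/-- `y` is the immediate successor of `x`. -/
def IsSucc (a : OrderDatum L N) (x y : a.X) : Prop :=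
  a.lt x y ∧ ∀ z, ¬ (a.lt x z ∧ a.lt z y)

/-- `x` is the least element `0_a`. -/
def IsZero (a : OrderDatum L N) (x : a.X) : Prop := ∀ y, a.le x y

/-- `a` is nontrivial: `d_a` is not a finite successor of `0_a`. -/
def Nontrivial (a : OrderDatum L N) : Prop :=
  ∀ z, a.IsZero z → ¬ Relation.ReflTransGen a.IsSucc z a.d

/-- `≤_a` is a discrete linear order on `X_a` with a least element, and it is pseudofinite with
respect to `Lp`: every bounded nonempty subset of `X_a` that is definable with parameters in the
`Lp`-structure `N` has a least and a greatest element. -/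
structure IsPseudofiniteOrder (Lp : FirstOrder.Language.{v', w'}) [Lp.Structure N]
    (a : OrderDatum L N) : Prop where
  antisymm : ∀ x y, a.le x y → a.le y x → x = y
  trans : ∀ x y z, a.le x y → a.le y z → a.le x z
  total : ∀ x y, a.le x y ∨ a.le y x
  exists_zero : ∃ z, a.IsZero z
  exists_succ : ∀ x, (∃ y, a.lt x y) → ∃ y, a.IsSucc x y
  exists_pred : ∀ x, (∃ y, a.lt y x) → ∃ y, a.IsSucc y x
  pseudofinite : ∀ S : Set a.X,
    Set.Definable (Set.univ : Set N) Lp {v : Fin a.φ.arity → N | ∃ x ∈ S, v = x.1} →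
    S.Nonempty → (∃ u, ∀ x ∈ S, a.le x u) →
    (∃ m ∈ S, ∀ x ∈ S, a.le m x) ∧ (∃ m ∈ S, ∀ x ∈ S, a.le x m)

/-- `P` is a bijection from `X_a × X_b` onto `X_e` whose graph (hence whose coordinate projections)
is definable with parameters in the `Lp`-structure `N`. -/
def IsDefinablePairing (Lp : FirstOrder.Language.{v', w'}) [Lp.Structure N]
    (a b e : OrderDatum L N) (P : a.X × b.X → e.X) : Prop :=
  Function.Bijective P ∧
  Set.Definable (Set.univ : Set N) Lp
    {v : Fin a.φ.arity ⊕ Fin b.φ.arity ⊕ Fin e.φ.arity → N |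
      ∃ (x : a.X) (y : b.X), v = Sum.elim x.1 (Sum.elim y.1 (P (x, y)).1)}

end OrderDatum

/-! ### Definable trees -/

/-- The formulas which, uniformly in the parameters `(c̄_a, d_a)`, describe the trees attached to
the orders with defining formula `φ`: the set of nodes (coded by `dim`-tuples), the length function,
the evaluation function, and the order by initial segment. -/
structure TreeFormulas {L : FirstOrder.Language.{v, w}} (Lp : FirstOrder.Language.{v', w'}) (φ : OrderFormula L) where
  dim : ℕ
  node : Lp.Formula (Fin dim ⊕ Fin φ.params ⊕ Fin φ.arity)
  lgn : Lp.Formula (Fin dim ⊕ Fin φ.arity ⊕ Fin φ.params ⊕ Fin φ.arity)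
  val : Lp.Formula (Fin dim ⊕ Fin φ.arity ⊕ Fin φ.arity ⊕ Fin φ.params ⊕ Fin φ.arity)
  init : Lp.Formula (Fin dim ⊕ Fin dim ⊕ Fin φ.params ⊕ Fin φ.arity)

namespace OrderDatum

variable {L : FirstOrder.Language.{v, w}} {Lp : FirstOrder.Language.{v', w'}} {N : Type u}
  [L.Structure N] [Lp.Structure N]

/-- The set of nodes of the tree `T_a`. -/
def Tree (a : OrderDatum L N) (τ : TreeFormulas Lp a.φ) : Set (Fin τ.dim → N) :=
  {b | τ.node.Realize (Sum.elim b (Sum.elim a.c a.d.1))}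

/-- `lgn_a(b) = l`. -/
def Lgn (a : OrderDatum L N) (τ : TreeFormulas Lp a.φ) (b : a.Tree τ) (l : a.X) : Prop :=
  τ.lgn.Realize (Sum.elim b.1 (Sum.elim l.1 (Sum.elim a.c a.d.1)))

/-- `b(n) = x`. -/
def Val (a : OrderDatum L N) (τ : TreeFormulas Lp a.φ) (b : a.Tree τ) (n x : a.X) : Prop :=
  τ.val.Realize (Sum.elim b.1 (Sum.elim n.1 (Sum.elim x.1 (Sum.elim a.c a.d.1))))

/-- `b₁ ⊴_a b₂`. -/
def Init (a : OrderDatum L N) (τ : TreeFormulas Lp a.φ) (b₁ b₂ : a.Tree τ) : Prop :=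
  τ.init.Realize (Sum.elim b₁.1 (Sum.elim b₂.1 (Sum.elim a.c a.d.1)))

/-- `T_a` is a tree of partial functions from `X_a` to itself, ordered by initial segment. A node
`b` codes a function with domain `{n : n <_a lgn_a(b)}`, where `lgn_a(b) ≤_a d_a`. -/
structure IsTree (a : OrderDatum L N) (τ : TreeFormulas Lp a.φ) : Prop where
  lgn_exists_unique : ∀ b, ∃! l, a.Lgn τ b l
  lgn_le : ∀ b l, a.Lgn τ b l → a.le l a.d
  val_exists_unique : ∀ b l, a.Lgn τ b l → ∀ n, a.lt n l → ∃! x, a.Val τ b n x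
  /-- `⊴_a` is the relation of being an initial segment. -/
  init_iff : ∀ b₁ b₂, a.Init τ b₁ b₂ ↔
    ∃ l₁ l₂, a.Lgn τ b₁ l₁ ∧ a.Lgn τ b₂ l₂ ∧ a.le l₁ l₂ ∧
      ∀ n, a.lt n l₁ → ∃ x, a.Val τ b₁ n x ∧ a.Val τ b₂ n x
  /-- Nodes are functions: each is determined by its length and its values. -/
  ext : ∀ b₁ b₂, a.Init τ b₁ b₂ → a.Init τ b₂ b₁ → b₁ = b₂
  /-- The empty function is a node. -/
  root : ∃ b, ∃ z, a.IsZero z ∧ a.Lgn τ b z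
  /-- Concatenation: if `lgn_a(b) <_a d_a` then `b⌢⟨x⟩` is a node. -/
  concat : ∀ b l, a.Lgn τ b l → a.lt l a.d → ∀ x,
    ∃ b' l', a.Init τ b b' ∧ a.IsSucc l l' ∧ a.Lgn τ b' l' ∧ a.Val τ b' l x

end OrderDatum

/-! ### Cofinality spectrum problems -/

/-- A cofinality spectrum problem `s = (M, N, M⁺, N⁺, Δ)`. The `L`-structures `M`, `N` have
expansions `M⁺`, `N⁺` to the language `Lp` (on the same underlying sets), and `M⁺` is elementarily
embedded in `N⁺` (hence `M` in `N`). `Or` is the set of distinguished orders of `s`. -/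
structure CSP where
  L : FirstOrder.Language.{v, w}
  Lp : FirstOrder.Language.{v', w'}
  incl : L →ᴸ Lp
  incl_injective : incl.Injective
  M : Type u'
  N : Type u
  [structM : L.Structure M]
  [structN : L.Structure N]
  [structMp : Lp.Structure M]
  [structNp : Lp.Structure N]
  expansionM : incl.IsExpansionOn M
  expansionN : incl.IsExpansionOn N
  elementary : M ↪ₑ[Lp] N
  Δ : Set (OrderFormula L)
  Or : Set (OrderDatum L N)
  mem_Δ : ∀ a ∈ Or, a.φ ∈ Δ
  /-- Every nonempty set `{ā : N ⊨ φ(ā, ā; c̄)}` with `φ ∈ Δ` carries an order of `s`. -/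
  exists_order : ∀ φ ∈ Δ, ∀ c : Fin φ.params → N, (φ.Carrier c).Nonempty →
    ∃ d : φ.Carrier c, OrderDatum.mk φ c d ∈ Or
  order : ∀ a ∈ Or, a.IsPseudofiniteOrder Lp
  /-- Closure under Cartesian products; the product of nontrivial orders can be taken nontrivial. -/
  prod : ∀ a ∈ Or, ∀ b ∈ Or, ∃ e ∈ Or,
    (∃ P, OrderDatum.IsDefinablePairing Lp a b e P) ∧
    (a.Nontrivial → b.Nontrivial → e.Nontrivial)
  /-- For some nontrivial `a` there is a product `a × a` whose order is compatible with `≤_a`: each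
  square `{(x₁, x₂) : x₁, x₂ ≤_a x}` is an initial segment of it with a last element. -/
  good_prod : ∃ a ∈ Or, a.Nontrivial ∧ ∃ e ∈ Or, ∃ P,
    OrderDatum.IsDefinablePairing Lp a a e P ∧
    ∀ x, ∃ y, ∀ x₁ x₂, (a.le x₁ x ∧ a.le x₂ x) ↔ e.le (P (x₁, x₂)) y
  /-- The formulas for the trees (only those with `φ ∈ Δ` matter). -/
  treeFormulas : ∀ φ : OrderFormula L, TreeFormulas Lp φ
  tree : ∀ a ∈ Or, a.IsTree (treeFormulas a.φ)

attribute [instance] CSP.structM CSP.structN CSP.structMp CSP.structNp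

/-- The strict linear order `lt` on `X` has a `(κ₁, κ₂)`-cut: a strictly increasing
`κ₁`-sequence below a strictly decreasing `κ₂`-sequence with no element between them. -/
def HasCut {X : Type u} (lt : X → X → Prop) (κ₁ κ₂ : Cardinal.{u}) : Prop :=
  ∃ (a : κ₁.ord.ToType → X) (b : κ₂.ord.ToType → X),
    (∀ i j, i < j → lt (a i) (a j)) ∧ (∀ i j, i < j → lt (b j) (b i)) ∧
    (∀ i j, lt (a i) (b j)) ∧
    ¬ ∃ x, (∀ i, lt (a i) x) ∧ (∀ j, lt x (b j))

namespace CSP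

/-- The cut spectrum `C(s)`: the pairs of (infinite) regular cardinals `(κ₁, κ₂)` such that some
nontrivial order of `s` has a `(κ₁, κ₂)`-cut. -/
def cutSpectrum (s : CSP.{u, u', v, w, v', w'}) : Set (Cardinal.{u} × Cardinal.{u}) :=
  {p | p.1.IsRegular ∧ p.2.IsRegular ∧ ∃ a ∈ s.Or, a.Nontrivial ∧ HasCut a.lt p.1 p.2}

/-- `𝔭_s`, the least `κ₁ + κ₂` with `(κ₁, κ₂) ∈ C(s)` (`⊤` if there is none). -/
noncomputable def p (s : CSP.{u, u', v, w, v', w'}) : WithTop Cardinal.{u} :=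
  sInf {κ | ∃ κ₁ κ₂, (κ₁, κ₂) ∈ s.cutSpectrum ∧ κ = ((κ₁ + κ₂ : Cardinal.{u}) : WithTop _)}

/-- In some tree of `s` there is a strictly increasing `κ`-indexed sequence with no upper bound. -/
def HasUnboundedPath (s : CSP.{u, u', v, w, v', w'}) (κ : Cardinal.{u}) : Prop :=
  ∃ a ∈ s.Or, ∃ f : κ.ord.ToType → a.Tree (s.treeFormulas a.φ),
    (∀ i j, i < j → a.Init _ (f i) (f j) ∧ f i ≠ f j) ∧
    ¬ ∃ b, ∀ i, a.Init _ (f i) b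

/-- `𝔱_s`, the least `κ` such that some tree of `s` has a strictly increasing `κ`-indexed sequence
with no upper bound (`⊤` if there is none). -/
noncomputable def t (s : CSP.{u, u', v, w, v', w'}) : WithTop Cardinal.{u} :=
  sInf {κ | ∃ μ : Cardinal.{u}, s.HasUnboundedPath μ ∧ κ = (μ : WithTop _)}

end CSP

end CofinalitySpectrum

/-!
Let `κ` be regular with `κ ≤ 𝔭_s` and `κ < 𝔱_s`.

*Existence.* In a nontrivial order there are increasing `κ`-sequences below the designated element
`d` (`exists_strictMono_of_no_gap`). They are built so that `d` is never a finite successor of a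
term; a limit stage can fail only if the earlier terms and the finite predecessors of `d` form a
`(μ, ℵ₀)`-cut with `μ < κ`, which `κ ≤ 𝔭_s` excludes. The upper bounds of such a sequence have no
least element, because non-minimal elements have predecessors, so their coinitiality is a regular
`θ` and `(κ, θ)` belongs to the spectrum. Read in the dual order, the same argument gives some
`(θ', κ)` in the spectrum.

*Comparison.* Let `a` and `b` be increasing `κ`-sequences in definable orders `A` and `B`, and let
the elements of a nontrivial order `e` code the pairs in `A × B`. In the tree of `e`, build a path
whose `i`-th node is strictly ascending in both coordinates and ends with `(a i, b i)`
(`PairTree.IsRich.exists_path`). Since `κ < 𝔱_s`, earlier nodes always have a common extension; by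
pseudofiniteness it can be cut down to its longest initial segment that is ascending and stays below
the next pair (`pairTree_trunc`). To keep the lengths below `d_e`, they are bounded along an
increasing `κ`-sequence in `e` fixed in advance. Finally the whole path has an ascending extension
`t`. Its two coordinates are increasing definable functions of the position, so by pseudofiniteness
each identifies the coinitiality of the positions of `t` above the whole path with the coinitiality
of the upper bounds of `a`, respectively of `b` (`cof_eq_of_strictMonoOn`). Hence the two cuts have
the same right-hand length (`hasGap_unique`).

With `A` and `B` two orders of `s` this is uniqueness of `θ`; with `B` replaced by its dual it
equates the `θ` of `(κ, θ)` with that of `(θ, κ)`, which is symmetry.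

Definability of the sets to which pseudofiniteness is applied is obtained from a small calculus of
definable predicates on types coded by tuples, closed under connectives, quantifiers and
substitution.
-/

section OrderTheory

open Cardinal Order Set

universe u

/-! ### Cofinal sequences in linear orders -/

/-- Every linear order has a cofinal subset that is well ordered: the records of a well-ordering of
the underlying set. -/
theorem exists_isCofinal_wellFoundedLT (α : Type*) [LinearOrder α] :
    ∃ t : Set α, IsCofinal t ∧ WellFoundedLT t := by
  obtain ⟨r, hr, -⟩ := Cardinal.exists_ord_eq α
  refine ⟨_, isCofinal_setOfPred_imp_lt r, ⟨?_⟩⟩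
  refine Subrelation.wf (r := fun x y : {a | ∀ b, r b a → b < a} => r x.1 y.1) ?_
    (InvImage.wf Subtype.val hr.wf)
  intro x y hxy
  rcases trichotomous_of r x.1 y.1 with h | h | h
  · exact h
  · exact absurd (Subtype.ext h) (ne_of_lt hxy)
  · exact absurd (x.2 _ h) (not_lt_of_gt hxy)

/-- Every linear order has a strictly increasing cofinal sequence of length its cofinality. -/
theorem exists_strictMono_isCofinal_range (α : Type*) [LinearOrder α] :
    ∃ f : (cof α).ord.ToType → α, StrictMono f ∧ IsCofinal (range f) := by
  obtain ⟨t, ht, hw⟩ := exists_isCofinal_wellFoundedLT α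
  obtain ⟨s, hs, hs'⟩ := Ordinal.exists_ord_cof_eq t
  rw [cof_eq_of_isCofinal ht, ← Ordinal.type_toType (cof α).ord, Ordinal.type_eq] at hs'
  obtain ⟨e⟩ := hs'
  refine ⟨fun i => (e.symm i : t).1, fun i j hij => ?_, fun x => ?_⟩
  · exact e.symm.map_rel_iff.2 hij
  · obtain ⟨y, hy, hxy⟩ := ht x
    obtain ⟨z, hz, hyz⟩ := hs ⟨y, hy⟩
    exact ⟨z, ⟨e ⟨z, hz⟩, by simp⟩, hxy.trans hyz⟩

theorem isRegular_order_cof (α : Type*) [LinearOrder α] [Nonempty α] [NoMaxOrder α] :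
    (cof α).IsRegular := by
  obtain ⟨t, ht, hw⟩ := exists_isCofinal_wellFoundedLT α
  refine ⟨aleph0_le_cof, ?_⟩
  rw [← cof_eq_of_isCofinal ht, Order.cof_ord_cof]

/-- A strictly decreasing sequence of regular length `θ`, coinitial in `α`, computes the
coinitiality of `α`. -/
theorem cof_orderDual_eq_of_strictAnti {α : Type*} [LinearOrder α] {θ : Cardinal}
    (hθ : θ.IsRegular) {b : θ.ord.ToType → α} (hb : StrictAnti b) (hc : ∀ x, ∃ j, b j ≤ x) :
    cof αᵒᵈ = θ := by
  have h : StrictMono (OrderDual.toDual ∘ b) := fun i j hij => hb hij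
  rw [← cof_congr_of_strictMono h, Ordinal.cof_toType, hθ.cof_ord]
  intro x
  obtain ⟨j, hj⟩ := hc (OrderDual.ofDual x)
  exact ⟨_, ⟨j, rfl⟩, hj⟩

/-- Transfinite recursion for sequences constrained by a unary condition `U` on each term and a
binary condition `Q` between each term and every earlier one: such a sequence exists as soon as
every partial one can be prolonged. -/
theorem exists_sequence_of_extend {I T : Type*} [LinearOrder I] [WellFoundedLT I] [Nonempty T]
    (U : I → T → Prop) (Q : I → I → T → T → Prop)
    (h : ∀ i (c : I → T), (∀ j < i, U j (c j)) →
      (∀ j < i, ∀ k < j, Q k j (c k) (c j)) → ∃ t, U i t ∧ ∀ j < i, Q j i (c j) t) :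
    ∃ c : I → T, (∀ i, U i (c i)) ∧ ∀ j i, j < i → Q j i (c j) (c i) := by
  classical
  inhabit T
  let step : ∀ i, (∀ j, j < i → T) → T := fun i prev =>
    if H : ∃ t, U i t ∧ ∀ j (hj : j < i), Q j i (prev j hj) t then H.choose else default
  let c : I → T := (wellFounded_lt (α := I)).fix step
  have hc : ∀ i, c i = step i (fun j _ => c j) := fun i => WellFounded.fix_eq _ _ _
  have key : ∀ i, U i (c i) ∧ ∀ j < i, Q j i (c j) (c i) := by
    intro i
    induction i using WellFoundedLT.induction with
    | ind i ih =>
      have H := h i c (fun j hj => (ih j hj).1) (fun j hj k hk => (ih j hj).2 k hk)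
      rw [hc i]
      simp only [step]
      rw [dif_pos H]
      exact H.choose_spec
  exact ⟨c, fun i => (key i).1, fun j i hji => (key i).2 j hji⟩

/-! ### Cuts in discrete linear orders -/

/-- A gap: an increasing `κ₁`-sequence below a decreasing `κ₂`-sequence, with nothing between. This
is the notion of a cut for an arbitrary linear order, so that it applies to order duals. -/
def HasGap (Y : Type u) [LinearOrder Y] (κ₁ κ₂ : Cardinal.{u}) : Prop :=
  ∃ (a : κ₁.ord.ToType → Y) (b : κ₂.ord.ToType → Y), StrictMono a ∧ StrictAnti b ∧
    (∀ i j, a i < b j) ∧ ¬ ∃ x, (∀ i, a i < x) ∧ ∀ j, x < b j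

theorem HasGap.dual {Y : Type u} [LinearOrder Y] {κ₁ κ₂ : Cardinal.{u}} (h : HasGap Y κ₁ κ₂) :
    HasGap Yᵒᵈ κ₂ κ₁ := by
  obtain ⟨a, b, ha, hb, hab, hn⟩ := h
  exact ⟨fun i => OrderDual.toDual (b i), fun i => OrderDual.toDual (a i),
    fun i j hij => hb hij, fun i j hij => ha hij, fun i j => hab j i,
    fun ⟨x, h₁, h₂⟩ => hn ⟨OrderDual.ofDual x, fun i => h₂ i, fun j => h₁ j⟩⟩

/-- Sequences indexed by arbitrary linear orders can be thinned out to cofinal sequences of the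
length required in a gap. -/
theorem HasGap.of_linearOrder {Y I J : Type u} [LinearOrder Y] [LinearOrder I] [LinearOrder J]
    {a : I → Y} {b : J → Y} (ha : StrictMono a) (hb : StrictAnti b) (hab : ∀ i j, a i < b j)
    (hn : ¬ ∃ x, (∀ i, a i < x) ∧ ∀ j, x < b j) : HasGap Y (cof I) (cof J) := by
  obtain ⟨f, hf, hf'⟩ := exists_strictMono_isCofinal_range I
  obtain ⟨g, hg, hg'⟩ := exists_strictMono_isCofinal_range J
  refine ⟨a ∘ f, b ∘ g, ha.comp hf, hb.comp_strictMono hg, fun i j => hab _ _, ?_⟩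
  rintro ⟨x, h₁, h₂⟩
  refine hn ⟨x, fun i => ?_, fun j => ?_⟩
  · obtain ⟨_, ⟨k, rfl⟩, hk⟩ := hf' i
    exact (ha.monotone hk).trans_lt (h₁ k)
  · obtain ⟨_, ⟨k, rfl⟩, hk⟩ := hg' j
    exact (h₂ k).trans_le (hb.antitone hk)

theorem mk_Iio_ord_lt {κ : Cardinal} (i : κ.ord.ToType) : #(Iio i) < κ := by
  simpa using mk_Iio_lt i (by simp)

theorem Cardinal.IsRegular.nonempty_toType {κ : Cardinal} (hκ : κ.IsRegular) :
    Nonempty κ.ord.ToType := by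
  rw [Ordinal.nonempty_toType_iff]
  simpa using hκ.ne_zero

/-- In a gap with regular right-hand length `θ`, the set of strict upper bounds of the left half
has coinitiality `θ`. -/
theorem HasGap.exists_cof_eq {Y : Type u} [LinearOrder Y] {κ θ : Cardinal.{u}} (hθ : θ.IsRegular)
    (h : HasGap Y κ θ) : ∃ a : κ.ord.ToType → Y, StrictMono a ∧ (∃ y, ∀ i, a i < y) ∧
      cof {y // ∀ i, a i < y}ᵒᵈ = θ := by
  obtain ⟨a, b, ha, hb, hab, hn⟩ := h
  obtain ⟨j₀⟩ := hθ.nonempty_toType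
  refine ⟨a, ha, ⟨b j₀, fun i => hab i _⟩, ?_⟩
  refine cof_orderDual_eq_of_strictAnti hθ
    (b := fun j => (⟨b j, fun i => hab i j⟩ : {y // ∀ i, a i < y})) (fun i j hij => hb hij) ?_
  rintro ⟨x, hx⟩
  by_contra! hcon
  exact hn ⟨x, hx, fun j => hcon j⟩

/-- In an order where non-minimal elements have predecessors, a bounded strictly increasing
sequence of regular length is the left half of a gap. -/
theorem exists_hasGap_of_strictMono {Y : Type u} [LinearOrder Y] {κ : Cardinal.{u}}
    (hκ : κ.IsRegular) (hpred : ∀ x y : Y, x < y → ∃ z, z ⋖ y)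
    {a : κ.ord.ToType → Y} (ha : StrictMono a) {d : Y} (hd : ∀ i, a i < d) :
    ∃ θ : Cardinal, θ.IsRegular ∧ HasGap Y κ θ := by
  have := Cardinal.noMaxOrder hκ.aleph0_le
  obtain ⟨i₀⟩ := hκ.nonempty_toType
  -- The predecessor of a strict upper bound is again one: a term not below it would be followed by
  -- a term strictly between the two. So there is no least strict upper bound.
  let Q := {y // ∀ i, a i < y}
  have : Nonempty Qᵒᵈ := ⟨OrderDual.toDual ⟨d, hd⟩⟩
  have : NoMinOrder Q := by
    refine ⟨fun ⟨y, hy⟩ => ?_⟩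
    obtain ⟨p, hp⟩ := hpred _ _ (hy i₀)
    refine ⟨⟨p, fun i => ?_⟩, hp.lt⟩
    obtain ⟨j, hj⟩ := exists_gt i
    exact (ha hj).trans_le (le_of_not_gt fun h => hp.2 h (hy j))
  refine ⟨cof Qᵒᵈ, isRegular_order_cof _, ?_⟩
  have h := HasGap.of_linearOrder (J := Qᵒᵈ) (b := fun q => (OrderDual.ofDual q).1) ha
    (fun p q hpq => hpq) (fun i q => (OrderDual.ofDual q).2 i)
    (fun ⟨x, hx, hx'⟩ => lt_irrefl _ (hx' (OrderDual.toDual ⟨x, hx⟩)))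
  rwa [Ordinal.cof_toType, hκ.cof_ord] at h

/-- If `d` is not a finite successor of `z`, then the predecessors of `d` form an infinite
decreasing sequence, which exhausts the elements of which `d` is a finite successor. -/
theorem exists_nat_covBy_of_not_reflTransGen {Y : Type*} [LinearOrder Y] {z d : Y}
    (hzd : z < d) (hnt : ¬ Relation.ReflTransGen (· ⋖ ·) z d)
    (hpred : ∀ y, z < y → y ≤ d → ∃ p, p ⋖ y) :
    ∃ b : ℕ → Y, StrictAnti b ∧ (∀ n, z < b n ∧ b n ≤ d) ∧
      (∀ n, Relation.ReflTransGen (· ⋖ ·) (b n) d) ∧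
      ∀ x, Relation.ReflTransGen (· ⋖ ·) x d → ∃ n, x = b n := by
  -- Predecessors are iterated within the elements above `z` of which `d` is a finite successor;
  -- `z` itself is never reached.
  have hD : ∀ y : {y // z < y ∧ y ≤ d ∧ Relation.ReflTransGen (· ⋖ ·) y d},
      ∃ p : {y // z < y ∧ y ≤ d ∧ Relation.ReflTransGen (· ⋖ ·) y d}, p.1 ⋖ y.1 := by
    rintro ⟨y, hzy, hyd, hy⟩
    obtain ⟨p, hp⟩ := hpred y hzy hyd
    have hpd : Relation.ReflTransGen (· ⋖ ·) p d := .head hp hy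
    have hzp : z ≤ p := le_of_not_gt fun h => hp.2 h hzy
    refine ⟨⟨p, lt_of_le_of_ne hzp ?_, hp.le.trans hyd, hpd⟩, hp⟩
    rintro rfl
    exact hnt hpd
  choose pr hpr using hD
  let b : ℕ → {y // z < y ∧ y ≤ d ∧ Relation.ReflTransGen (· ⋖ ·) y d} :=
    fun n => pr^[n] ⟨d, hzd, le_rfl, .refl⟩
  have hb : ∀ n, (b (n + 1)).1 ⋖ (b n).1 := fun n => by
    simp only [b, Function.iterate_succ_apply']
    exact hpr _
  refine ⟨fun n => (b n).1, strictAnti_nat_of_succ_lt fun n => (hb n).lt,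
    fun n => ⟨(b n).2.1, (b n).2.2.1⟩, fun n => (b n).2.2.2, fun x hx => ?_⟩
  induction hx using Relation.ReflTransGen.head_induction_on with
  | refl => exact ⟨0, rfl⟩
  | head hxy _ ih =>
    obtain ⟨n, rfl⟩ := ih
    exact ⟨n + 1, hxy.unique_left (hb n)⟩

/-- If `d` is not a finite successor of `z` and there are no `(μ, ℵ₀)`-gaps with `μ < κ` regular,
then a `κ`-sequence fits between `z` and `d`. The terms are chosen so that `d` is not a finite
successor of any of them: at limit stages, the gap that would stop the construction is the one
between the earlier terms and the finite predecessors of `d`. -/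
theorem exists_strictMono_of_no_gap {Y : Type u} [LinearOrder Y] {κ : Cardinal.{u}} {z d : Y}
    (hzd : z ≤ d) (hnt : ¬ Relation.ReflTransGen (· ⋖ ·) z d)
    (hpred : ∀ y, z < y → y ≤ d → ∃ p, p ⋖ y) (hsucc : ∀ y, z ≤ y → y < d → ∃ q, y ⋖ q)
    (hgap : ∀ μ : Cardinal.{u}, μ < κ → μ.IsRegular → ¬ HasGap Y μ ℵ₀) :
    ∃ f : κ.ord.ToType → Y, StrictMono f ∧ ∀ i, z ≤ f i ∧ f i < d := by
  have hzd' : z < d := lt_of_le_of_ne hzd fun h => hnt (h ▸ .refl)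
  have : Nonempty Y := ⟨z⟩
  have key := exists_sequence_of_extend (I := κ.ord.ToType) (T := Y)
    (fun _ x => z ≤ x ∧ x < d ∧ ¬ Relation.ReflTransGen (· ⋖ ·) x d) (fun _ _ x y => x < y)
  suffices h : _ by
    obtain ⟨f, hf, hf'⟩ := key h
    exact ⟨f, fun i j hij => hf' i j hij, fun i => ⟨(hf i).1, (hf i).2.1⟩⟩
  intro i c hc hmono
  rcases isEmpty_or_nonempty (Iio i) with he | hne
  · exact ⟨z, ⟨le_rfl, hzd', hnt⟩, fun j hj => (he.false ⟨j, hj⟩).elim⟩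
  by_cases htop : ∃ x : Iio i, IsTop x
  · obtain ⟨⟨j, hj⟩, htop⟩ := htop
    obtain ⟨h₁, h₂, h₃⟩ := hc j hj
    obtain ⟨q, hq⟩ := hsucc _ h₁ h₂
    have hqd : ¬ Relation.ReflTransGen (· ⋖ ·) q d := fun h => h₃ (.head hq h)
    refine ⟨q, ⟨h₁.trans hq.le, lt_of_le_of_ne (le_of_not_gt fun h => hq.2 h₂ h) ?_, hqd⟩,
      fun k hk => ?_⟩
    · rintro rfl
      exact hqd .refl
    · rcases (show k ≤ j from htop ⟨k, hk⟩).lt_or_eq with h | rfl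
      · exact (hmono j hj k h).trans hq.lt
      · exact hq.lt
  · -- Without a last earlier term, a failure at stage `i` makes the earlier terms and the finite
    -- predecessors of `d` a gap with left-hand length `cof (Iio i) < κ`.
    obtain ⟨b, hb, hbz, hbd, hbx⟩ := exists_nat_covBy_of_not_reflTransGen hzd' hnt hpred
    have : NoMaxOrder (Iio i) := ⟨fun x => by
      by_contra! h
      exact htop ⟨x, h⟩⟩
    have : Countable (range b)ᵒᵈ := (countable_range b).to_subtype
    have : NoMaxOrder (range b)ᵒᵈ := ⟨by
      rintro ⟨_, n, rfl⟩
      exact ⟨⟨_, n + 1, rfl⟩, hb n.lt_succ_self⟩⟩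
    have hlt : cof (Iio i) < κ := (cof_le_cardinalMk _).trans_lt (mk_Iio_ord_lt i)
    have hreg : (cof (Iio i)).IsRegular := isRegular_order_cof _
    by_contra! hcon
    have hcb : ∀ j < i, ∀ n, c j < b n := by
      intro j hj n
      obtain ⟨-, h₂, h₃⟩ := hc j hj
      have hall : ∀ y, Relation.ReflTransGen (· ⋖ ·) y d → c j < y := by
        intro y hy
        induction hy using Relation.ReflTransGen.head_induction_on with
        | refl => exact h₂
        | head hxy hyd ih =>
          refine lt_of_le_of_ne (le_of_not_gt fun h => hxy.2 h ih) ?_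
          rintro rfl
          exact h₃ (.head hxy hyd)
      exact hall _ (hbd n)
    refine hgap _ hlt hreg ?_
    have h := HasGap.of_linearOrder (I := Iio i) (J := (range b)ᵒᵈ) (a := fun j => c j)
      (b := fun x => (OrderDual.ofDual x).1) (fun j k hjk => hmono k k.2 j hjk) (fun x y hxy => hxy)
      (by rintro ⟨j, hj⟩ ⟨_, n, rfl⟩; exact hcb j hj n) ?_
    · rwa [cof_eq_aleph0 (α := (range b)ᵒᵈ)] at h
    · rintro ⟨x, hx, hx'⟩
      have hxb : ∀ n, x < b n := fun n => hx' ⟨_, n, rfl⟩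
      obtain ⟨j⟩ := hne
      obtain ⟨k, hk, hk'⟩ := hcon x ⟨(hc j j.2).1.trans (hx j).le, (hxb 0).trans_le (hbz 0).2,
        fun h => by
          obtain ⟨n, rfl⟩ := hbx x h
          exact lt_irrefl _ (hxb n)⟩
      exact hk'.not_gt (hx ⟨k, hk⟩)

end OrderTheory

section Definability

open Set FirstOrder

/-! ### A calculus of definable predicates -/

/-- A type identified with a definable set of finite tuples from the structure `N`. Products of coded
types are coded by juxtaposition, so that a predicate in several variables is one on a product. -/
class Coded (L : Language) (N : Type*) [L.Structure N] (X : Type*) where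
  ι : Type
  finite : Finite ι
  toTuple : X → ι → N
  injective : Function.Injective toTuple
  definable_range : (univ : Set N).Definable L (range toTuple)

namespace Coded

/-- The tuple coding an element of a coded type. -/
abbrev code (L : Language) {N X : Type*} [L.Structure N] [Coded L N X] (x : X) : ι L N X → N :=
  toTuple x

variable (L : Language) (N : Type*) [L.Structure N] {X Y Z : Type*}
  [Coded L N X] [Coded L N Y] [Coded L N Z]

instance : Finite (ι L N X) := finite

instance : Coded L N (X × Y) where
  ι := ι L N X ⊕ ι L N Y
  finite := inferInstance
  toTuple z := Sum.elim (code L z.1) (code L z.2)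
  injective z w h := by
    rw [Sum.elim_eq_iff] at h
    exact Prod.ext (injective h.1) (injective h.2)
  definable_range := by
    convert ((definable_range (L := L) (N := N) (X := X)).preimage_comp
      (Sum.inl : _ → ι L N X ⊕ ι L N Y)).inter ((definable_range (L := L) (N := N)
      (X := Y)).preimage_comp (Sum.inr : _ → ι L N X ⊕ ι L N Y)) using 1
    ext v
    constructor
    · rintro ⟨z, rfl⟩
      exact ⟨⟨z.1, rfl⟩, ⟨z.2, rfl⟩⟩
    · rintro ⟨⟨x, hx⟩, ⟨y, hy⟩⟩
      refine ⟨(x, y), ?_⟩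
      exact (congrArg₂ Sum.elim hx hy).trans (Sum.elim_comp_inl_inr v)

/-- Definability with parameters, for a predicate on a coded type. -/
def DefPred (p : X → Prop) : Prop :=
  (univ : Set N).Definable L {v | ∃ x : X, p x ∧ v = code L x}

/-- A map that acts on codes as a map of tuples with definable coordinates. Only projections,
constants and their combinations are needed. -/
def IsCodedMap (f : X → Y) : Prop :=
  ∃ F : (ι L N X → N) → ι L N Y → N, (univ : Set N).DefinableMap L F ∧
    ∀ x, code L (f x) = F (code L x)

variable {L N}

theorem IsCodedMap.id : IsCodedMap L N (fun x : X => x) :=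
  ⟨fun v => v, fun _ => DefinableFun.proj L, fun _ => rfl⟩

theorem IsCodedMap.fst {f : X → Y × Z} (hf : IsCodedMap L N f) :
    IsCodedMap L N (fun x => (f x).1) := by
  obtain ⟨F, hF, h⟩ := hf
  exact ⟨fun v i => F v (Sum.inl i), fun i => hF _, fun x => funext fun i => congrFun (h x) (Sum.inl i)⟩

theorem IsCodedMap.snd {f : X → Y × Z} (hf : IsCodedMap L N f) :
    IsCodedMap L N (fun x => (f x).2) := by
  obtain ⟨F, hF, h⟩ := hf
  exact ⟨fun v i => F v (Sum.inr i), fun i => hF _, fun x => funext fun i => congrFun (h x) (Sum.inr i)⟩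

theorem IsCodedMap.const (y : Y) : IsCodedMap L N (fun _ : X => y) :=
  ⟨fun _ => code L y, fun _ => L.definableFun_const _ (mem_univ _), fun _ => rfl⟩

theorem IsCodedMap.prodMk {f : X → Y} {g : X → Z} (hf : IsCodedMap L N f)
    (hg : IsCodedMap L N g) : IsCodedMap L N (fun x => (f x, g x)) := by
  obtain ⟨F, hF, h⟩ := hf
  obtain ⟨G, hG, h'⟩ := hg
  refine ⟨fun v => Sum.elim (F v) (G v), ?_, fun x => ?_⟩
  · rintro (i | i)
    · exact hF i
    · exact hG i
  · exact congrArg₂ Sum.elim (h x) (h' x)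

theorem IsCodedMap.comp {g : Y → Z} {f : X → Y} (hg : IsCodedMap L N g) (hf : IsCodedMap L N f) :
    IsCodedMap L N (fun x => g (f x)) := by
  obtain ⟨F, hF, h⟩ := hf
  obtain ⟨G, hG, h'⟩ := hg
  exact ⟨fun v => G (F v), fun i => (hG i).comp hF, fun x => by rw [h', h]⟩

namespace DefPred

variable {p q : X → Prop}

/-- Substitution of a definable map into a definable predicate. -/
theorem comp {p : Y → Prop} (hp : DefPred L N p) {f : X → Y} (hf : IsCodedMap L N f) :
    DefPred L N (fun x => p (f x)) := by
  obtain ⟨F, hF, h⟩ := hf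
  unfold DefPred at *
  convert (definable_range (L := L) (N := N) (X := X)).inter (Definable.preimage_map hF hp) using 1
  ext v
  constructor
  · rintro ⟨x, hx, rfl⟩
    exact ⟨⟨x, rfl⟩, f x, hx, (h x).symm⟩
  · rintro ⟨⟨x, rfl⟩, y, hy, hxy⟩
    rw [← h] at hxy
    obtain rfl := injective hxy
    exact ⟨x, hy, rfl⟩

theorem comp₂ {r : Y → Z → Prop} (hr : DefPred L N (fun z : Y × Z => r z.1 z.2))
    {f : X → Y} {g : X → Z} (hf : IsCodedMap L N f) (hg : IsCodedMap L N g) :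
    DefPred L N (fun x => r (f x) (g x)) :=
  hr.comp (hf.prodMk hg)

theorem congr (hp : DefPred L N p) (h : ∀ x, q x ↔ p x) : DefPred L N q := by
  rwa [show q = p from funext fun x => propext (h x)]

theorem and (hp : DefPred L N p) (hq : DefPred L N q) : DefPred L N (fun x => p x ∧ q x) := by
  unfold DefPred at *
  convert Definable.inter hp hq using 1
  ext v
  constructor
  · rintro ⟨x, ⟨h₁, h₂⟩, rfl⟩
    exact ⟨⟨x, h₁, rfl⟩, x, h₂, rfl⟩
  · rintro ⟨⟨x, h₁, rfl⟩, y, h₂, hxy⟩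
    exact ⟨x, ⟨h₁, injective hxy ▸ h₂⟩, rfl⟩

theorem not (hp : DefPred L N p) : DefPred L N (fun x => ¬ p x) := by
  unfold DefPred at *
  convert (definable_range (L := L) (N := N) (X := X)).sdiff hp using 1
  ext v
  constructor
  · rintro ⟨x, hx, rfl⟩
    exact ⟨⟨x, rfl⟩, fun ⟨y, hy, hxy⟩ => hx (injective hxy ▸ hy)⟩
  · rintro ⟨⟨x, rfl⟩, hx⟩
    exact ⟨x, fun h => hx ⟨x, h, rfl⟩, rfl⟩

theorem imp (hp : DefPred L N p) (hq : DefPred L N q) : DefPred L N (fun x => p x → q x) :=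
  (hp.and hq.not).not.congr fun x => by tauto

theorem ex {p : X → Y → Prop} (hp : DefPred L N (fun z : X × Y => p z.1 z.2)) :
    DefPred L N (fun x => ∃ y, p x y) := by
  unfold DefPred at *
  convert Definable.image_comp hp (Sum.inl : _ → ι L N X ⊕ ι L N Y) using 1
  ext v
  constructor
  · rintro ⟨x, ⟨y, hxy⟩, rfl⟩
    exact ⟨_, ⟨(x, y), hxy, rfl⟩, rfl⟩
  · rintro ⟨_, ⟨z, hz, rfl⟩, rfl⟩
    exact ⟨z.1, ⟨z.2, hz⟩, rfl⟩

theorem all {p : X → Y → Prop} (hp : DefPred L N (fun z : X × Y => p z.1 z.2)) :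
    DefPred L N (fun x => ∀ y, p x y) :=
  (ex (p := fun x y => ¬ p x y) hp.not).not.congr fun x => by simp

end DefPred

end Coded

end Definability

section Trees

open Cardinal Order Set

universe u

/-! ### Ascending nodes in trees of pairs -/

/-- A strictly increasing function `g` on `{k | k < l}` for which every nonempty sublevel set has
a last element transports the coinitiality of the elements above a sequence `n` to that of the
elements above `g ∘ n = a`. -/
theorem cof_eq_of_strictMonoOn {X A I : Type u} [LinearOrder X] [LinearOrder A] [LinearOrder I]
    [NoMaxOrder I] [Nonempty I] {l : X} {g : X → A} (hg : StrictMonoOn g (Iio l)) {n : I → X}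
    (hn : StrictMono n) (hnl : ∀ i, n i < l)
    {a : I → A} (hgn : ∀ i, g (n i) = a i)
    (hlast : ∀ y, (∃ k < l, g k ≤ y) → ∃ k < l, g k ≤ y ∧ ∀ m < l, g m ≤ y → m ≤ k) :
    cof {k // k < l ∧ ∀ i, n i < k}ᵒᵈ = cof {y // ∀ i, a i < y}ᵒᵈ := by
  obtain rfl : (fun i => g (n i)) = a := funext hgn
  obtain ⟨i₀⟩ := ‹Nonempty I›
  let f : {k // k < l ∧ ∀ i, n i < k}ᵒᵈ → {y // ∀ i, g (n i) < y}ᵒᵈ := fun k =>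
    OrderDual.toDual ⟨g (OrderDual.ofDual k).1,
      fun i => hg (hnl i) (OrderDual.ofDual k).2.1 ((OrderDual.ofDual k).2.2 i)⟩
  have hf : StrictMono f := fun k m hkm =>
    hg (OrderDual.ofDual m).2.1 (OrderDual.ofDual k).2.1 hkm
  refine cof_congr_of_strictMono hf fun y => ?_
  obtain ⟨y, hy⟩ := y
  obtain ⟨k, hkl, hky, hk⟩ := hlast y ⟨n i₀, hnl i₀, (hy i₀).le⟩
  refine ⟨_, ⟨OrderDual.toDual ⟨k, hkl, fun i => ?_⟩, rfl⟩, hky⟩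
  obtain ⟨j, hj⟩ := exists_gt i
  exact (hn hj).trans_le (hk _ (hnl j) (hy j).le)

/-- A family of nodes, each with a length in `X` and, at the positions below it, values in
`A × B`. The values at positions from the length on are irrelevant. -/
structure PairTree (X A B T : Type u) where
  len : T → X
  fst : T → X → A
  snd : T → X → B

namespace PairTree

variable {X A B T : Type u} [LinearOrder X]

/-- `s` is an initial segment of `t`. -/
def Init (S : PairTree X A B T) (s t : T) : Prop :=
  S.len s ≤ S.len t ∧ ∀ n < S.len s, S.fst s n = S.fst t n ∧ S.snd s n = S.snd t n

theorem Init.trans {S : PairTree X A B T} {r s t : T} (h₁ : S.Init r s) (h₂ : S.Init s t) :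
    S.Init r t := by
  refine ⟨h₁.1.trans h₂.1, fun n hn => ?_⟩
  obtain ⟨h, h'⟩ := h₁.2 n hn
  obtain ⟨k, k'⟩ := h₂.2 n (hn.trans_le h₁.1)
  exact ⟨h.trans k, h'.trans k'⟩

variable [LinearOrder A] [LinearOrder B]

/-- The restriction of `t` to `{n | n < l}` is strictly increasing in both coordinates, with
values below `x` and `y`. -/
def AscendsTo (S : PairTree X A B T) (x : A) (y : B) (t : T) (l : X) : Prop :=
  ∀ n < l, (S.fst t n < x ∧ S.snd t n < y) ∧
    ∀ m < n, S.fst t m < S.fst t n ∧ S.snd t m < S.snd t n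

/-- The closure properties of the tree that the comparison of two cuts relies on: concatenation
below the height `d`; a longest ascending initial segment with given bounds on length and values;
upper bounds for paths of cofinality at most `κ`; and last elements of sublevel sets of the two
coordinates. -/
structure IsRich (S : PairTree X A B T) (d : X) (κ : Cardinal.{u}) : Prop where
  concat : ∀ t x y, S.len t < d →
    ∃ t', S.Init t t' ∧ S.len t ⋖ S.len t' ∧ S.fst t' (S.len t) = x ∧ S.snd t' (S.len t) = y
  trunc : ∀ t x y e, ∃ t', S.Init t' t ∧ S.len t' ≤ e ∧ S.AscendsTo x y t' (S.len t') ∧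
    ∀ s, S.Init s t → S.len s ≤ e → S.AscendsTo x y s (S.len s) → S.Init s t'
  bound : ∀ (J : Type u) [LinearOrder J], cof J ≤ κ → ∀ c : J → T,
    (∀ i j, i < j → S.Init (c i) (c j) ∧ c i ≠ c j) → ∃ t, ∀ i, S.Init (c i) t
  last_fst : ∀ t x, (∃ k < S.len t, S.fst t k ≤ x) →
    ∃ k < S.len t, S.fst t k ≤ x ∧ ∀ m < S.len t, S.fst t m ≤ x → m ≤ k
  last_snd : ∀ t y, (∃ k < S.len t, S.snd t k ≤ y) →
    ∃ k < S.len t, S.snd t k ≤ y ∧ ∀ m < S.len t, S.snd t m ≤ y → m ≤ k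

variable {S : PairTree X A B T} {d : X} {κ : Cardinal.{u}}

/-- A path of ascending nodes has an upper bound that is itself ascending, with the same bounds on
length and values. -/
theorem IsRich.exists_bound (hS : S.IsRich d κ) {J : Type u} [LinearOrder J]
    (hJ : cof J ≤ κ) {c : J → T} (hc : ∀ i j, i < j → S.Init (c i) (c j) ∧ c i ≠ c j)
    {x : A} {y : B} {e : X}
    (hx : ∀ i, S.len (c i) ≤ e ∧ S.AscendsTo x y (c i) (S.len (c i))) :
    ∃ t, S.len t ≤ e ∧ S.AscendsTo x y t (S.len t) ∧ ∀ i, S.Init (c i) t := by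
  obtain ⟨t, ht⟩ := hS.bound J hJ c hc
  obtain ⟨t', -, h₂, h₃, h₄⟩ := hS.trunc t x y e
  exact ⟨t', h₂, h₃, fun i => h₄ _ (ht i) (hx i).1 (hx i).2⟩

/-- `t` is ascending, and its last value, at a position not exceeding `e`, is `(x, y)`. -/
def EndsWith (S : PairTree X A B T) (x : A) (y : B) (e : X) (t : T) : Prop :=
  ∃ n, n ⋖ S.len t ∧ n ≤ e ∧ S.fst t n = x ∧ S.snd t n = y ∧
    ∀ k < S.len t, ∀ m < k, S.fst t m < S.fst t k ∧ S.snd t m < S.snd t k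

/-- The last value of an ascending node dominates all of its values. The length is only one more
than the last position, hence at most `e'`. -/
theorem EndsWith.ascendsTo {x x' : A} {y y' : B} {e e' : X} {t : T} (h : S.EndsWith x y e t)
    (hx : x < x') (hy : y < y') (he : e < e') :
    S.len t ≤ e' ∧ S.AscendsTo x' y' t (S.len t) := by
  obtain ⟨n, hn, hne, rfl, rfl, hinc⟩ := h
  refine ⟨le_of_not_gt fun hlt => hn.2 (hne.trans_lt he) hlt, fun k hk => ⟨?_, hinc k hk⟩⟩
  rcases (le_of_not_gt fun hlt => hn.2 hlt hk : k ≤ n).lt_or_eq with h | rfl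
  · exact ⟨(hinc n hn.lt k h).1.trans hx, (hinc n hn.lt k h).2.trans hy⟩
  · exact ⟨hx, hy⟩

/-- A path in the tree whose `i`-th node ends with the pair `(a i, b i)`. At every stage the
earlier nodes have a common extension; truncating it to its longest ascending initial segment of
length at most `e i` with values below `(a i, b i)` makes room for the next value. -/
theorem IsRich.exists_path [Nonempty T] (hS : S.IsRich d κ) {e : κ.ord.ToType → X}
    {a : κ.ord.ToType → A} {b : κ.ord.ToType → B} (he : StrictMono e) (hed : ∀ i, e i < d)
    (ha : StrictMono a) (hb : StrictMono b) :
    ∃ c : κ.ord.ToType → T, (∀ i, S.EndsWith (a i) (b i) (e i) (c i)) ∧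
      ∀ i j, i < j → S.Init (c i) (c j) ∧ c i ≠ c j := by
  refine exists_sequence_of_extend (fun i t => S.EndsWith (a i) (b i) (e i) t)
    (fun _ _ s t => S.Init s t ∧ s ≠ t) fun i c hc hpath => ?_
  obtain ⟨t, hte, hta, ht⟩ := hS.exists_bound (J := Iio i) (c := fun j => c j)
    ((cof_le_cardinalMk _).trans (mk_Iio_ord_lt i).le) (fun j k hjk => hpath k k.2 j hjk)
    (fun j => (hc j j.2).ascendsTo (ha j.2) (hb j.2) (he j.2))
  obtain ⟨t', htt', hcov, hfst, hsnd⟩ := hS.concat t (a i) (b i) (hte.trans_lt (hed i))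
  refine ⟨t', ⟨_, hcov, hte, hfst, hsnd, fun k hk m hm => ?_⟩, fun j hj =>
    ⟨(ht ⟨j, hj⟩).trans htt', fun h => ?_⟩⟩
  · rcases (le_of_not_gt fun hlt => hcov.2 hlt hk : k ≤ S.len t).lt_or_eq with h | rfl
    · rw [← (htt'.2 k h).1, ← (htt'.2 k h).2, ← (htt'.2 m (hm.trans h)).1,
        ← (htt'.2 m (hm.trans h)).2]
      exact (hta k h).2 m hm
    · rw [hfst, hsnd, ← (htt'.2 m hm).1, ← (htt'.2 m hm).2]
      exact (hta m hm).1
  · exact ((ht ⟨j, hj⟩).1.trans_lt hcov.lt).ne (congrArg S.len h)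

/-- Two increasing `κ`-sequences, one in each coordinate, have strict upper bounds of the same
coinitiality: both coinitialities equal that of the positions, in an ascending node extending the
whole path, above all positions where the two sequences are listed. -/
theorem IsRich.cof_eq [Nonempty T] (hS : S.IsRich d κ) (hκ : κ.IsRegular) {e : κ.ord.ToType → X}
    {a : κ.ord.ToType → A} {b : κ.ord.ToType → B} (he : StrictMono e) (hed : ∀ i, e i < d)
    (ha : StrictMono a) (hb : StrictMono b) (hax : ∃ x, ∀ i, a i < x) (hby : ∃ y, ∀ i, b i < y) :
    cof {x // ∀ i, a i < x}ᵒᵈ = cof {y // ∀ i, b i < y}ᵒᵈ := by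
  have := Cardinal.noMaxOrder hκ.aleph0_le
  have := hκ.nonempty_toType
  obtain ⟨x, hx⟩ := hax
  obtain ⟨y, hy⟩ := hby
  obtain ⟨c, hc, hpath⟩ := hS.exists_path he hed ha hb
  obtain ⟨t, -, hta, ht⟩ := hS.exists_bound (J := κ.ord.ToType)
    ((cof_le_cardinalMk _).trans (by simp)) hpath
    (fun i => (hc i).ascendsTo (hx i) (hy i) (hed i))
  -- `n i` is the position at which `t` takes the value `(a i, b i)`.
  choose n hn _ hfst hsnd _ using hc
  have hnl : ∀ i, n i < S.len t := fun i => (hn i).lt.trans_le (ht i).1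
  have hmono₁ : StrictMonoOn (S.fst t) (Iio (S.len t)) := fun m _ k hk hmk => ((hta k hk).2 m hmk).1
  have hmono₂ : StrictMonoOn (S.snd t) (Iio (S.len t)) := fun m _ k hk hmk => ((hta k hk).2 m hmk).2
  have hfst' : ∀ i, S.fst t (n i) = a i := fun i => by
    rw [← ((ht i).2 _ (hn i).lt).1, hfst]
  have hsnd' : ∀ i, S.snd t (n i) = b i := fun i => by
    rw [← ((ht i).2 _ (hn i).lt).2, hsnd]
  have hninc : StrictMono n := fun i j hij => by
    rw [← hmono₁.lt_iff_lt (hnl i) (hnl j), hfst', hfst']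
    exact ha hij
  have h₁ := cof_eq_of_strictMonoOn hmono₁ hninc hnl hfst' (hS.last_fst t)
  have h₂ := cof_eq_of_strictMonoOn hmono₂ hninc hnl hsnd' (hS.last_snd t)
  exact h₁.symm.trans h₂

end PairTree

end Trees

section Spectrum

open Set FirstOrder

/-! ### The orders of a cofinality spectrum problem -/

namespace Coded

theorem definable_setOfPred_realize {L : Language} {N α : Type*} [L.Structure N] (ψ : L.Formula α) :
    (univ : Set N).Definable L {v | ψ.Realize v} :=
  Definable.mono (empty_definable_iff.2 ⟨ψ, rfl⟩) (empty_subset _)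

/-- The predicate obtained by evaluating a formula at definable functions of a code. -/
theorem DefPred.of_formula {L : Language} {N X α : Type*} [L.Structure N] [Coded L N X] [Finite α]
    (ψ : L.Formula α) {F : (ι L N X → N) → α → N} (hF : (univ : Set N).DefinableMap L F) :
    DefPred L N (fun x : X => ψ.Realize (F (code L x))) := by
  unfold DefPred
  convert (definable_range (L := L) (N := N) (X := X)).inter
    ((definable_setOfPred_realize ψ).preimage_map hF) using 1
  ext v
  constructor
  · rintro ⟨x, hx, rfl⟩
    exact ⟨⟨x, rfl⟩, hx⟩
  · rintro ⟨⟨x, rfl⟩, hx⟩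
    exact ⟨x, hx, rfl⟩

instance (L : Language) (N X : Type*) [L.Structure N] [Coded L N X] : Coded L N Xᵒᵈ :=
  inferInstanceAs (Coded L N X)

end Coded

namespace CofinalitySpectrum.CSP

open Coded

universe u u' v w v' w'

variable {s : CSP.{u, u', v, w, v', w'}}

/-- Elements of `X_a` are already tuples. The defining formula is moved from `L` to `L⁺`. -/
instance (a : OrderDatum s.L s.N) : Coded s.Lp s.N a.X where
  ι := Fin a.φ.arity
  finite := inferInstance
  toTuple := Subtype.val
  injective := Subtype.val_injective
  definable_range := by
    have := s.expansionN
    have hF : (univ : Set s.N).DefinableMap s.Lp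
        (fun v : Fin a.φ.arity → s.N => Sum.elim v (Sum.elim v a.c)) := by
      rintro (i | i | i)
      · exact DefinableFun.proj _
      · exact DefinableFun.proj _
      · exact s.Lp.definableFun_const _ (mem_univ _)
    rw [Subtype.range_coe]
    convert (definable_setOfPred_realize (s.incl.onFormula a.φ.formula)).preimage_map hF using 1
    ext v
    exact (s.incl.realize_onFormula a.φ.formula).symm

/-- The order `≤_a`, as a linear order on `X_a`. -/
noncomputable instance (a : s.Or) : LinearOrder a.1.X where
  le := a.1.le
  le_refl x := (or_self_iff.1 ((s.order _ a.2).total x x) : _)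
  le_trans := (s.order _ a.2).trans
  le_antisymm := (s.order _ a.2).antisymm
  le_total := (s.order _ a.2).total
  toDecidableLE := Classical.decRel _

theorem lt_iff (a : s.Or) (x y : a.1.X) : a.1.lt x y ↔ x < y :=
  (lt_iff_le_and_ne (a := x) (b := y)).symm

theorem isSucc_iff (a : s.Or) (x y : a.1.X) : a.1.IsSucc x y ↔ x ⋖ y := by
  simp only [OrderDatum.IsSucc, lt_iff, CovBy, not_and]

theorem exists_succ (a : s.Or) {x y : a.1.X} (h : x < y) : ∃ z, x ⋖ z := by
  simpa only [isSucc_iff] using (s.order _ a.2).exists_succ x ⟨y, (lt_iff a x y).2 h⟩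

theorem exists_pred (a : s.Or) {x y : a.1.X} (h : x < y) : ∃ z, z ⋖ y := by
  simpa only [isSucc_iff] using (s.order _ a.2).exists_pred y ⟨x, (lt_iff a x y).2 h⟩

theorem defPred_le (a : s.Or) :
    DefPred s.Lp s.N (fun z : a.1.X × a.1.X => z.1 ≤ z.2) := by
  have := s.expansionN
  let F : (Fin a.1.φ.arity ⊕ Fin a.1.φ.arity → s.N) →
      Fin a.1.φ.arity ⊕ Fin a.1.φ.arity ⊕ Fin a.1.φ.params → s.N :=
    fun v => Sum.elim (v ∘ Sum.inl) (Sum.elim (v ∘ Sum.inr) a.1.c)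
  have hF : (univ : Set s.N).DefinableMap s.Lp F := by
    rintro (i | i | i)
    · exact DefinableFun.proj _
    · exact DefinableFun.proj _
    · exact s.Lp.definableFun_const _ (mem_univ _)
  refine (DefPred.of_formula (X := a.1.X × a.1.X) (s.incl.onFormula a.1.φ.formula) hF).congr
    fun z => ?_
  exact (s.incl.realize_onFormula a.1.φ.formula).symm

theorem exists_isGreatest (a : s.Or) {p : a.1.X → Prop} (hp : DefPred s.Lp s.N p)
    (hne : ∃ x, p x) {u : a.1.X} (hu : ∀ x, p x → x ≤ u) : ∃ m, p m ∧ ∀ x, p x → x ≤ m :=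
  ((s.order _ a.2).pseudofinite {x | p x} hp hne ⟨u, hu⟩).2

theorem exists_isLeast (a : s.Or) {p : a.1.X → Prop} (hp : DefPred s.Lp s.N p)
    (hne : ∃ x, p x) {u : a.1.X} (hu : ∀ x, p x → x ≤ u) : ∃ m, p m ∧ ∀ x, p x → m ≤ x :=
  ((s.order _ a.2).pseudofinite {x | p x} hp hne ⟨u, hu⟩).1

theorem hasCut_iff (a : s.Or) (κ₁ κ₂ : Cardinal.{u}) :
    HasCut a.1.lt κ₁ κ₂ ↔ HasGap a.1.X κ₁ κ₂ := by
  simp only [HasCut, HasGap, lt_iff, StrictMono, StrictAnti]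

theorem mem_cutSpectrum_iff {κ θ : Cardinal.{u}} : (κ, θ) ∈ s.cutSpectrum ↔
    κ.IsRegular ∧ θ.IsRegular ∧ ∃ a : s.Or, a.1.Nontrivial ∧ HasGap a.1.X κ θ := by
  simp only [cutSpectrum, mem_ofPred_eq, Subtype.exists]
  refine and_congr_right fun _ => and_congr_right fun _ => exists_congr fun a => ⟨?_, ?_⟩
  · rintro ⟨ha, h₁, h₂⟩
    exact ⟨ha, h₁, (hasCut_iff ⟨a, ha⟩ _ _).1 h₂⟩
  · rintro ⟨ha, h₁, h₂⟩
    exact ⟨ha, h₁, (hasCut_iff ⟨a, ha⟩ _ _).2 h₂⟩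

/-! ### The trees of a cofinality spectrum problem -/

/-- The set of nodes of the tree attached to an order. -/
abbrev Node (a : s.Or) : Type u := a.1.Tree (s.treeFormulas a.1.φ)

instance (a : s.Or) : Coded s.Lp s.N (Node a) where
  ι := Fin (s.treeFormulas a.1.φ).dim
  finite := inferInstance
  toTuple := Subtype.val
  injective := Subtype.val_injective
  definable_range := by
    have hF : (univ : Set s.N).DefinableMap s.Lp
        (fun v : Fin (s.treeFormulas a.1.φ).dim → s.N => Sum.elim v (Sum.elim a.1.c a.1.d.1)) := by
      rintro (i | i | i)
      · exact DefinableFun.proj _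
      · exact s.Lp.definableFun_const _ (mem_univ _)
      · exact s.Lp.definableFun_const _ (mem_univ _)
    rw [Subtype.range_coe]
    exact (definable_setOfPred_realize _).preimage_map hF

/-- The length of a node. -/
noncomputable def len (a : s.Or) (t : Node a) : a.1.X :=
  ((s.tree _ a.2).lgn_exists_unique t).choose

theorem lgn_iff (a : s.Or) (t : Node a) (l : a.1.X) : a.1.Lgn _ t l ↔ l = len a t := by
  have h := ((s.tree _ a.2).lgn_exists_unique t).choose_spec
  exact ⟨h.2 l, fun hl => hl ▸ h.1⟩

open Classical in
/-- The value of a node at a position below its length; elsewhere the junk value is the position. -/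
noncomputable def val (a : s.Or) (t : Node a) (n : a.1.X) : a.1.X :=
  if h : n < len a t then
    ((s.tree _ a.2).val_exists_unique t _ ((lgn_iff a t _).2 rfl) n ((lt_iff a _ _).2 h)).choose
  else n

theorem val_iff (a : s.Or) {t : Node a} {n : a.1.X} (h : n < len a t) (x : a.1.X) :
    a.1.Val _ t n x ↔ val a t n = x := by
  have h' := ((s.tree _ a.2).val_exists_unique t _ ((lgn_iff a t _).2 rfl) n
    ((lt_iff a _ _).2 h)).choose_spec
  rw [val, dif_pos h]
  exact ⟨fun hx => (h'.2 x hx).symm, fun hx => hx ▸ h'.1⟩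

theorem len_le (a : s.Or) (t : Node a) : len a t ≤ a.1.d :=
  (s.tree _ a.2).lgn_le t _ ((lgn_iff a t _).2 rfl)

theorem init_iff (a : s.Or) (t₁ t₂ : Node a) : a.1.Init _ t₁ t₂ ↔
    len a t₁ ≤ len a t₂ ∧ ∀ n < len a t₁, val a t₁ n = val a t₂ n := by
  rw [(s.tree _ a.2).init_iff]
  simp only [lgn_iff, lt_iff]
  constructor
  · rintro ⟨_, _, rfl, rfl, h, h'⟩
    refine ⟨h, fun n hn => ?_⟩
    obtain ⟨x, h₁, h₂⟩ := h' n hn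
    rw [(val_iff a hn x).1 h₁, (val_iff a (hn.trans_le h) x).1 h₂]
  · rintro ⟨h, h'⟩
    refine ⟨_, _, rfl, rfl, h, fun n hn => ⟨_, (val_iff a hn _).2 rfl, ?_⟩⟩
    exact (val_iff a (hn.trans_le h) _).2 (h' n hn).symm

theorem exists_root (a : s.Or) : ∃ t : Node a, ∀ x, len a t ≤ x := by
  obtain ⟨t, z, hz, ht⟩ := (s.tree _ a.2).root
  obtain rfl := (lgn_iff a t z).1 ht
  exact ⟨t, hz⟩

theorem exists_concat (a : s.Or) {t : Node a} (h : len a t < a.1.d) (x : a.1.X) :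
    ∃ t', a.1.Init _ t t' ∧ len a t ⋖ len a t' ∧ val a t' (len a t) = x := by
  obtain ⟨t', l', h₁, h₂, h₃, h₄⟩ :=
    (s.tree _ a.2).concat t _ ((lgn_iff a t _).2 rfl) ((lt_iff a _ _).2 h) x
  obtain rfl := (lgn_iff a t' l').1 h₃
  rw [isSucc_iff] at h₂
  exact ⟨t', h₁, h₂, (val_iff a h₂.lt x).1 h₄⟩

theorem defPred_val (a : s.Or) (t : Node a) :
    DefPred s.Lp s.N (fun z : a.1.X × a.1.X => a.1.Val _ t z.1 z.2) := by
  let F : (Fin a.1.φ.arity ⊕ Fin a.1.φ.arity → s.N) → Fin (s.treeFormulas a.1.φ).dim ⊕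
      Fin a.1.φ.arity ⊕ Fin a.1.φ.arity ⊕ Fin a.1.φ.params ⊕ Fin a.1.φ.arity → s.N :=
    fun v => Sum.elim t.1
      (Sum.elim (v ∘ Sum.inl) (Sum.elim (v ∘ Sum.inr) (Sum.elim a.1.c a.1.d.1)))
  have hF : (univ : Set s.N).DefinableMap s.Lp F := by
    rintro (i | i | i | i | i)
    · exact s.Lp.definableFun_const _ (mem_univ _)
    · exact DefinableFun.proj _
    · exact DefinableFun.proj _
    · exact s.Lp.definableFun_const _ (mem_univ _)
    · exact s.Lp.definableFun_const _ (mem_univ _)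
  exact DefPred.of_formula (X := a.1.X × a.1.X) _ hF

theorem defPred_len (a : s.Or) :
    DefPred s.Lp s.N (fun z : Node a × a.1.X => z.2 = len a z.1) := by
  let F : (Fin (s.treeFormulas a.1.φ).dim ⊕ Fin a.1.φ.arity → s.N) →
      Fin (s.treeFormulas a.1.φ).dim ⊕ Fin a.1.φ.arity ⊕ Fin a.1.φ.params ⊕ Fin a.1.φ.arity →
        s.N :=
    fun v => Sum.elim (v ∘ Sum.inl) (Sum.elim (v ∘ Sum.inr) (Sum.elim a.1.c a.1.d.1))
  have hF : (univ : Set s.N).DefinableMap s.Lp F := by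
    rintro (i | i | i | i)
    · exact DefinableFun.proj _
    · exact DefinableFun.proj _
    · exact s.Lp.definableFun_const _ (mem_univ _)
    · exact s.Lp.definableFun_const _ (mem_univ _)
  exact (DefPred.of_formula (X := Node a × a.1.X) _ hF).congr fun z => (lgn_iff a _ _).symm

theorem defPred_init (a : s.Or) (t : Node a) :
    DefPred s.Lp s.N (fun t' : Node a => a.1.Init _ t' t) := by
  let F : (Fin (s.treeFormulas a.1.φ).dim → s.N) → Fin (s.treeFormulas a.1.φ).dim ⊕
      Fin (s.treeFormulas a.1.φ).dim ⊕ Fin a.1.φ.params ⊕ Fin a.1.φ.arity → s.N :=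
    fun v => Sum.elim v (Sum.elim t.1 (Sum.elim a.1.c a.1.d.1))
  have hF : (univ : Set s.N).DefinableMap s.Lp F := by
    rintro (i | i | i | i)
    · exact DefinableFun.proj _
    all_goals exact s.Lp.definableFun_const _ (mem_univ _)
  exact DefPred.of_formula (X := Node a) _ hF

/-- Every restriction of a node to a shorter length is a node: a least length for which this
fails would be a successor, and concatenation would then give the missing node. -/
theorem exists_restrict (a : s.Or) (t : Node a) {l : a.1.X} (hl : l ≤ len a t) :
    ∃ t', a.1.Init _ t' t ∧ len a t' = l := by
  by_contra hcon
  have hdef : DefPred s.Lp s.N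
      (fun l : a.1.X => l ≤ len a t ∧ ¬ ∃ t' : Node a, a.1.Init _ t' t ∧ l = len a t') := by
    refine ((defPred_le a).comp₂ .id (.const _)).and (DefPred.not (DefPred.ex ?_))
    exact ((defPred_init a t).comp (IsCodedMap.id.snd)).and
      ((defPred_len a).comp₂ (r := fun t l => l = len a t) IsCodedMap.id.snd IsCodedMap.id.fst)
  obtain ⟨m, ⟨hmt, hm⟩, hmin⟩ := exists_isLeast a hdef
    ⟨l, hl, fun ⟨t', h₁, h₂⟩ => hcon ⟨t', h₁, h₂.symm⟩⟩ (u := len a t) fun x hx => hx.1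
  obtain ⟨r, hr⟩ := exists_root a
  have hrm : len a r < m := by
    refine lt_of_le_of_ne (hr m) fun h => hm ⟨r, (init_iff a _ _).2 ⟨hr _, fun n hn => ?_⟩, h.symm⟩
    exact absurd (hr n) (not_le_of_gt hn)
  -- The least bad length `m` has a predecessor, which is the length of a restriction `t'` of `t`.
  obtain ⟨k, hk⟩ := exists_pred a hrm
  obtain ⟨t', ht', rfl⟩ : ∃ t' : Node a, a.1.Init _ t' t ∧ k = len a t' := by
    by_contra h
    exact absurd (hmin k ⟨hk.le.trans hmt, h⟩) (not_le_of_gt hk.lt)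
  obtain ⟨t'', h₁, h₂, h₃⟩ := exists_concat a ((hk.lt.trans_le hmt).trans_le (len_le a t))
    (val a t (len a t'))
  obtain rfl : len a t'' = m := h₂.unique_right hk
  refine hm ⟨t'', (init_iff a _ _).2 ⟨hmt, fun n hn => ?_⟩, rfl⟩
  rw [init_iff] at h₁ ht'
  rcases (le_of_not_gt fun h => h₂.2 h hn : n ≤ len a t').lt_or_eq with h | rfl
  · rw [← h₁.2 n h, ht'.2 n h]
  · exact h₃

open Cardinal Order

/-! ### Paths below `𝔱_s` and cuts below `𝔭_s` -/

theorem not_hasUnboundedPath {κ μ : Cardinal.{u}} (hκ : (κ : WithTop Cardinal) < s.t)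
    (hμ : μ ≤ κ) : ¬ s.HasUnboundedPath μ := by
  intro h
  have h' : s.t ≤ (μ : WithTop Cardinal) := csInf_le (OrderBot.bddBelow _) ⟨μ, h, rfl⟩
  exact absurd (hκ.trans_le h') (not_lt_of_ge (WithTop.coe_le_coe.2 hμ))

/-- Paths indexed by a linear order of cofinality at most `κ < 𝔱_s` are bounded: they can be thinned
out to cofinal paths indexed by that cofinality. -/
theorem exists_bound (a : s.Or) {κ : Cardinal.{u}} (hκ : (κ : WithTop Cardinal) < s.t)
    {J : Type u} [LinearOrder J] (hJ : cof J ≤ κ) (c : J → Node a)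
    (hc : ∀ i j, i < j → a.1.Init _ (c i) (c j) ∧ c i ≠ c j) : ∃ t, ∀ i, a.1.Init _ (c i) t := by
  obtain ⟨f, hf, hf'⟩ := exists_strictMono_isCofinal_range J
  by_contra hcon
  refine not_hasUnboundedPath hκ hJ ⟨a, a.2, c ∘ f, fun i j hij => hc _ _ (hf hij), ?_⟩
  rintro ⟨t, ht⟩
  refine hcon ⟨t, fun i => ?_⟩
  obtain ⟨_, ⟨k, rfl⟩, hk⟩ := hf' i
  rcases hk.lt_or_eq with h | rfl
  · have h₁ := (init_iff a _ _).1 (hc _ _ h).1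
    have h₂ := (init_iff a _ _).1 (ht k)
    exact (init_iff a _ _).2 ⟨h₁.1.trans h₂.1, fun n hn =>
      (h₁.2 n hn).trans (h₂.2 n (hn.trans_le h₁.1))⟩
  · exact ht k

theorem le_of_mem_cutSpectrum {κ μ θ : Cardinal.{u}} (hκ : (κ : WithTop Cardinal) ≤ s.p)
    (h : (μ, θ) ∈ s.cutSpectrum) : κ ≤ μ + θ :=
  WithTop.coe_le_coe.1 (hκ.trans (csInf_le (OrderBot.bddBelow _) ⟨μ, θ, h, rfl⟩))

theorem not_hasGap_aleph0 {κ μ : Cardinal.{u}} (hκ : (κ : WithTop Cardinal) ≤ s.p) (hμκ : μ < κ)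
    (hμ : μ.IsRegular) {a : s.Or} (ha : a.1.Nontrivial) :
    ¬ HasGap a.1.X μ ℵ₀ ∧ ¬ HasGap a.1.X ℵ₀ μ := by
  constructor <;> intro h
  · have := le_of_mem_cutSpectrum hκ (mem_cutSpectrum_iff.2 ⟨hμ, isRegular_aleph0, a, ha, h⟩)
    rw [Cardinal.add_eq_left hμ.aleph0_le hμ.aleph0_le] at this
    exact this.not_gt hμκ
  · have := le_of_mem_cutSpectrum hκ (mem_cutSpectrum_iff.2 ⟨isRegular_aleph0, hμ, a, ha, h⟩)
    rw [Cardinal.add_eq_right hμ.aleph0_le hμ.aleph0_le] at this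
    exact this.not_gt hμκ

theorem exists_zero (a : s.Or) : ∃ z : a.1.X, ∀ x, z ≤ x := (s.order _ a.2).exists_zero

theorem not_reflTransGen_covBy {a : s.Or} (ha : a.1.Nontrivial) {z : a.1.X} (hz : ∀ x, z ≤ x) :
    ¬ Relation.ReflTransGen (· ⋖ ·) z a.1.d := by
  have h := ha z hz
  rwa [show a.1.IsSucc = (· ⋖ ·) from funext₂ fun x y => propext (isSucc_iff a x y)] at h

/-- Below the designated element of a nontrivial order there are increasing `κ`-sequences. -/
theorem exists_increasing {κ : Cardinal.{u}} (hκ : (κ : WithTop Cardinal) ≤ s.p)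
    {a : s.Or} (ha : a.1.Nontrivial) :
    ∃ f : κ.ord.ToType → a.1.X, StrictMono f ∧ ∀ i, f i < a.1.d := by
  obtain ⟨z, hz⟩ := exists_zero a
  obtain ⟨f, hf, hf'⟩ := exists_strictMono_of_no_gap (κ := κ) (hz a.1.d)
    (not_reflTransGen_covBy ha hz) (fun y hy _ => exists_pred a hy) (fun y _ hy => exists_succ a hy)
    (fun μ hμκ hμ => (not_hasGap_aleph0 hκ hμκ hμ ha).1)
  exact ⟨f, hf, fun i => (hf' i).2⟩

/-- Every nontrivial order has a cut with left-hand length `κ`, for each regular `κ ≤ 𝔭_s`. -/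
theorem exists_hasGap {κ : Cardinal.{u}} (hκ : (κ : WithTop Cardinal) ≤ s.p) (hreg : κ.IsRegular)
    {a : s.Or} (ha : a.1.Nontrivial) : ∃ θ : Cardinal.{u}, θ.IsRegular ∧ HasGap a.1.X κ θ := by
  obtain ⟨f, hf, hfd⟩ := exists_increasing hκ ha
  exact exists_hasGap_of_strictMono hreg (fun x y h => exists_pred a h) hf hfd

/-- The mirror image of `exists_hasGap`, obtained from the dual order with its end points `d_a`
and `0_a` exchanged. -/
theorem exists_hasGap_dual {κ : Cardinal.{u}} (hκ : (κ : WithTop Cardinal) ≤ s.p)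
    (hreg : κ.IsRegular) {a : s.Or} (ha : a.1.Nontrivial) :
    ∃ θ : Cardinal.{u}, θ.IsRegular ∧ HasGap a.1.X θ κ := by
  obtain ⟨z, hz⟩ := exists_zero a
  have hpred : ∀ x y : a.1.Xᵒᵈ, x < y → ∃ p, p ⋖ y := fun x y h => by
    obtain ⟨p, hp⟩ := exists_succ a (x := OrderDual.ofDual y) (y := OrderDual.ofDual x) h
    exact ⟨OrderDual.toDual p, hp.toDual⟩
  have hsucc : ∀ x y : a.1.Xᵒᵈ, x < y → ∃ q, x ⋖ q := fun x y h => by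
    obtain ⟨p, hp⟩ := exists_pred a (x := OrderDual.ofDual y) (y := OrderDual.ofDual x) h
    exact ⟨OrderDual.toDual p, hp.toDual⟩
  have hnt : ¬ Relation.ReflTransGen (· ⋖ ·) (OrderDual.toDual a.1.d) (OrderDual.toDual z) := by
    intro h
    refine not_reflTransGen_covBy ha hz (Relation.reflTransGen_swap.1 ?_)
    exact h.lift OrderDual.ofDual fun x y hxy => hxy.ofDual
  obtain ⟨f, hf, hf'⟩ := exists_strictMono_of_no_gap (κ := κ) (Y := a.1.Xᵒᵈ)
    (hz a.1.d) hnt (fun y hy _ => hpred _ _ hy) (fun y _ hy => hsucc _ _ hy)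
    (fun μ hμκ hμ h => (not_hasGap_aleph0 hκ hμκ hμ ha).2 h.dual)
  obtain ⟨θ, hθ, h⟩ := exists_hasGap_of_strictMono hreg hpred hf fun i => (hf' i).2
  exact ⟨θ, hθ, h.dual⟩

/-! ### Functions with definable graph -/

section Graph

variable {X C : Type u} [LinearOrder X] {L : Language} {N : Type*} [L.Structure N]
  [Coded L N X] [Coded L N C]

theorem defPred_lt (hX : DefPred L N (fun z : X × X => z.1 ≤ z.2)) :
    DefPred L N (fun z : X × X => z.1 < z.2) :=
  (hX.comp₂ IsCodedMap.id.snd IsCodedMap.id.fst).not.congr fun _ => not_le.symm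

/-- Substitution of a function `g` on positions below `l`, given by its definable graph, into a
definable relation. The bound `l` is kept because `g` need not be definable beyond it. -/
theorem defPred_of_graph {W : Type*} [Coded L N W] {l : X} {g : X → C}
    (hg : DefPred L N (fun z : X × C => z.1 < l ∧ g z.1 = z.2)) {r : W × C → Prop}
    (hr : DefPred L N r) {n : W → X} (hn : IsCodedMap L N n) :
    DefPred L N (fun w => n w < l ∧ r (w, g (n w))) := by
  have h : DefPred L N (fun w => ∃ c, (n w < l ∧ g (n w) = c) ∧ r (w, c)) := by
    refine DefPred.ex (DefPred.and ?_ hr)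
    exact hg.comp₂ (r := fun m c => m < l ∧ g m = c) (hn.comp IsCodedMap.id.fst)
      IsCodedMap.id.snd
  refine h.congr fun w => ⟨fun ⟨h₁, h₂⟩ => ⟨_, ⟨h₁, rfl⟩, h₂⟩, ?_⟩
  rintro ⟨_, ⟨h₁, rfl⟩, h₂⟩
  exact ⟨h₁, h₂⟩

variable [LinearOrder C]

theorem defPred_lt_of_graph (hC : DefPred L N (fun z : C × C => z.1 ≤ z.2)) {l : X} {g : X → C}
    (hg : DefPred L N (fun z : X × C => z.1 < l ∧ g z.1 = z.2)) (c : C) :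
    DefPred L N (fun n => n < l ∧ g n < c) :=
  defPred_of_graph hg ((defPred_lt hC).comp₂ IsCodedMap.id.snd (.const c)) .id

theorem defPred_le_of_graph (hC : DefPred L N (fun z : C × C => z.1 ≤ z.2)) {l : X} {g : X → C}
    (hg : DefPred L N (fun z : X × C => z.1 < l ∧ g z.1 = z.2)) (c : C) :
    DefPred L N (fun n => n < l ∧ g n ≤ c) :=
  defPred_of_graph hg (hC.comp₂ (r := fun x y => x ≤ y) IsCodedMap.id.snd (.const c)) .id

theorem defPred_lt_lt_of_graph (hC : DefPred L N (fun z : C × C => z.1 ≤ z.2)) {l : X} {g : X → C}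
    (hg : DefPred L N (fun z : X × C => z.1 < l ∧ g z.1 = z.2)) :
    DefPred L N (fun z : X × X => z.1 < l ∧ z.2 < l ∧ g z.1 < g z.2) := by
  refine defPred_of_graph hg (r := fun w : (X × X) × C => w.1.2 < l ∧ w.2 < g w.1.2) ?_
    IsCodedMap.id.fst
  exact defPred_of_graph hg (r := fun w : ((X × X) × C) × C => w.1.2 < w.2)
    ((defPred_lt hC).comp₂ IsCodedMap.id.fst.snd IsCodedMap.id.snd) IsCodedMap.id.fst.snd

end Graph

theorem defPred_graph_val (a : s.Or) (t : Node a) :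
    DefPred s.Lp s.N (fun z : a.1.X × a.1.X => z.1 < len a t ∧ val a t z.1 = z.2) :=
  (((defPred_lt (defPred_le a)).comp₂ IsCodedMap.id.fst (.const _)).and (defPred_val a t)).congr
    fun z => and_congr_right fun h => (val_iff a h z.2).symm

/-! ### Comparing cuts along a path in a tree of pairs -/

/-- The tree of an order `e` whose elements code the pairs in `A × B`. -/
noncomputable def pairTree (e : s.Or) {A B : Type u} (P : A × B ≃ e.1.X) :
    PairTree e.1.X A B (Node e) where
  len := len e
  fst t n := (P.symm (val e t n)).1
  snd t n := (P.symm (val e t n)).2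

section PairTree

variable {e : s.Or} {A B : Type u} {P : A × B ≃ e.1.X}

/-- Decoding is injective, so agreeing pairs of values are agreeing values. -/
theorem pairTree_init_iff (t₁ t₂ : Node e) :
    (pairTree e P).Init t₁ t₂ ↔ e.1.Init _ t₁ t₂ := by
  rw [init_iff]
  refine and_congr_right fun _ => forall₂_congr fun n _ => ?_
  exact Prod.ext_iff.symm.trans P.symm.injective.eq_iff

variable [Coded s.Lp s.N A] [Coded s.Lp s.N B]

theorem defPred_graph_fst (hP : DefPred s.Lp s.N (fun z : (A × B) × e.1.X => P z.1 = z.2))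
    (t : Node e) : DefPred s.Lp s.N
      (fun z : e.1.X × A => z.1 < len e t ∧ (pairTree e P).fst t z.1 = z.2) := by
  refine defPred_of_graph (defPred_graph_val e t)
    (r := fun w : (e.1.X × A) × e.1.X => (P.symm w.2).1 = w.1.2) ?_ IsCodedMap.id.fst
  have h : DefPred s.Lp s.N (fun w : (e.1.X × A) × e.1.X => ∃ b : B, P (w.1.2, b) = w.2) :=
    DefPred.ex (hP.comp₂ (r := fun z x => P z = x)
      (IsCodedMap.id.fst.fst.snd.prodMk IsCodedMap.id.snd) IsCodedMap.id.fst.snd)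
  refine h.congr fun w => ⟨fun hw => ⟨(P.symm w.2).2, ?_⟩, fun ⟨b, hb⟩ => ?_⟩
  · rw [← hw, P.apply_symm_apply]
  · rw [← hb, P.symm_apply_apply]

theorem defPred_graph_snd (hP : DefPred s.Lp s.N (fun z : (A × B) × e.1.X => P z.1 = z.2))
    (t : Node e) : DefPred s.Lp s.N
      (fun z : e.1.X × B => z.1 < len e t ∧ (pairTree e P).snd t z.1 = z.2) := by
  refine defPred_of_graph (defPred_graph_val e t)
    (r := fun w : (e.1.X × B) × e.1.X => (P.symm w.2).2 = w.1.2) ?_ IsCodedMap.id.fst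
  have h : DefPred s.Lp s.N (fun w : (e.1.X × B) × e.1.X => ∃ a : A, P (a, w.1.2) = w.2) :=
    DefPred.ex (hP.comp₂ (r := fun z x => P z = x)
      (IsCodedMap.id.snd.prodMk IsCodedMap.id.fst.fst.snd) IsCodedMap.id.fst.snd)
  refine h.congr fun w => ⟨fun hw => ⟨(P.symm w.2).1, ?_⟩, fun ⟨a, ha⟩ => ?_⟩
  · rw [← hw, P.apply_symm_apply]
  · rw [← ha, P.symm_apply_apply]

variable [LinearOrder A] [LinearOrder B]

/-- The longest ascending initial segment of a node with prescribed bounds is again a node. -/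
theorem pairTree_trunc (hA : DefPred s.Lp s.N (fun z : A × A => z.1 ≤ z.2))
    (hB : DefPred s.Lp s.N (fun z : B × B => z.1 ≤ z.2))
    (hP : DefPred s.Lp s.N (fun z : (A × B) × e.1.X => P z.1 = z.2))
    (t : Node e) (x : A) (y : B) (l : e.1.X) :
    ∃ t', (pairTree e P).Init t' t ∧ len e t' ≤ l ∧ (pairTree e P).AscendsTo x y t' (len e t') ∧
      ∀ r, (pairTree e P).Init r t → len e r ≤ l → (pairTree e P).AscendsTo x y r (len e r) →
        (pairTree e P).Init r t' := by
  set S := pairTree e P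
  have hX := defPred_le e
  have hF := defPred_graph_fst hP t
  have hG := defPred_graph_snd hP t
  have hdef : DefPred s.Lp s.N
      (fun m : e.1.X => (m ≤ len e t ∧ m ≤ l) ∧ S.AscendsTo x y t m) := by
    -- Since `m ≤ len e t`, all positions involved lie below the length of `t`, and recording this
    -- at each of them changes nothing but makes the parts definable.
    have h : DefPred s.Lp s.N (fun m : e.1.X => (m ≤ len e t ∧ m ≤ l) ∧ ∀ n, n < m →
        ((n < len e t ∧ S.fst t n < x) ∧ (n < len e t ∧ S.snd t n < y)) ∧
          ∀ k, k < n → (k < len e t ∧ n < len e t ∧ S.fst t k < S.fst t n) ∧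
            (k < len e t ∧ n < len e t ∧ S.snd t k < S.snd t n)) := by
      refine ((hX.comp₂ .id (.const _)).and (hX.comp₂ .id (.const _))).and (DefPred.all
        (DefPred.imp ((defPred_lt hX).comp₂ IsCodedMap.id.snd IsCodedMap.id.fst) (DefPred.and
          (DefPred.and ((defPred_lt_of_graph hA hF x).comp IsCodedMap.id.snd)
            ((defPred_lt_of_graph hB hG y).comp IsCodedMap.id.snd)) (DefPred.all
          (DefPred.imp ((defPred_lt hX).comp₂ IsCodedMap.id.snd IsCodedMap.id.fst.snd)
            (DefPred.and ?_ ?_))))))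
      · exact (defPred_lt_lt_of_graph hA hF).comp
          (IsCodedMap.id.snd.prodMk IsCodedMap.id.fst.snd)
      · exact (defPred_lt_lt_of_graph hB hG).comp
          (IsCodedMap.id.snd.prodMk IsCodedMap.id.fst.snd)
    refine h.congr fun m => and_congr_right fun hm => ?_
    refine forall₂_congr fun n hn => ?_
    have hnt := hn.trans_le hm.1
    simp only [hnt, true_and]
    refine and_congr_right fun _ => forall₂_congr fun k hk => ?_
    simp only [hk.trans hnt, true_and]
  obtain ⟨r, hr⟩ := exists_root e
  obtain ⟨m, ⟨⟨hmt, hml⟩, hm⟩, hmax⟩ := exists_isGreatest e hdef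
    ⟨len e r, ⟨hr _, hr _⟩, fun n hn => absurd (hr n) (not_le_of_gt hn)⟩
    (u := l) (fun m hm => hm.1.2)
  have key : ∀ r : Node e, S.Init r t →
      (S.AscendsTo x y r (len e r) ↔ S.AscendsTo x y t (len e r)) := by
    refine fun r hr => forall₂_congr fun n hn => ?_
    obtain ⟨h₁, h₂⟩ := hr.2 n hn
    rw [h₁, h₂]
    refine and_congr_right fun _ => forall₂_congr fun k hk => ?_
    obtain ⟨h₃, h₄⟩ := hr.2 k (hk.trans hn)
    rw [h₃, h₄]
  obtain ⟨t', ht', rfl⟩ := exists_restrict e t hmt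
  rw [← pairTree_init_iff (P := P)] at ht'
  refine ⟨t', ht', hml, (key t' ht').2 hm, fun r hr hrl hra => ?_⟩
  have hle := hmax (len e r) ⟨⟨hr.1, hrl⟩, (key r hr).1 hra⟩
  refine ⟨hle, fun n hn => ?_⟩
  obtain ⟨h₁, h₂⟩ := hr.2 n hn
  obtain ⟨h₃, h₄⟩ := ht'.2 n (hn.trans_le hle)
  exact ⟨h₁.trans h₃.symm, h₂.trans h₄.symm⟩

theorem pairTree_isRich {κ : Cardinal.{u}} (hκ : (κ : WithTop Cardinal) < s.t)
    (hA : DefPred s.Lp s.N (fun z : A × A => z.1 ≤ z.2))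
    (hB : DefPred s.Lp s.N (fun z : B × B => z.1 ≤ z.2))
    (hP : DefPred s.Lp s.N (fun z : (A × B) × e.1.X => P z.1 = z.2)) :
    (pairTree e P).IsRich e.1.d κ where
  concat t x y ht := by
    obtain ⟨t', h₁, h₂, h₃⟩ := exists_concat e ht (P (x, y))
    refine ⟨t', (pairTree_init_iff _ _).2 h₁, h₂, ?_, ?_⟩
    · exact congrArg Prod.fst ((P.symm_apply_eq).2 h₃)
    · exact congrArg Prod.snd ((P.symm_apply_eq).2 h₃)
  trunc := pairTree_trunc hA hB hP
  bound J _ hJ c hc := by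
    simp only [pairTree_init_iff] at hc ⊢
    exact exists_bound e hκ hJ c hc
  last_fst t x h := by
    obtain ⟨k, ⟨h₁, h₂⟩, h₃⟩ := exists_isGreatest e
      (defPred_le_of_graph hA (defPred_graph_fst hP t) x) h (u := len e t) fun k hk => hk.1.le
    exact ⟨k, h₁, h₂, fun m hm hm' => h₃ m ⟨hm, hm'⟩⟩
  last_snd t y h := by
    obtain ⟨k, ⟨h₁, h₂⟩, h₃⟩ := exists_isGreatest e
      (defPred_le_of_graph hB (defPred_graph_snd hP t) y) h (u := len e t) fun k hk => hk.1.le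
    exact ⟨k, h₁, h₂, fun m hm hm' => h₃ m ⟨hm, hm'⟩⟩

/-- Two gaps of regular left-hand length `κ` in definable orders `A` and `B` have the same
right-hand length. -/
theorem hasGap_unique {κ θ₁ θ₂ : Cardinal.{u}} (hp : (κ : WithTop Cardinal) ≤ s.p)
    (ht : (κ : WithTop Cardinal) < s.t) (hκ : κ.IsRegular) (he : e.1.Nontrivial)
    (hA : DefPred s.Lp s.N (fun z : A × A => z.1 ≤ z.2))
    (hB : DefPred s.Lp s.N (fun z : B × B => z.1 ≤ z.2))
    (hP : DefPred s.Lp s.N (fun z : (A × B) × e.1.X => P z.1 = z.2))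
    (hθ₁ : θ₁.IsRegular) (hθ₂ : θ₂.IsRegular) (h₁ : HasGap A κ θ₁) (h₂ : HasGap B κ θ₂) :
    θ₁ = θ₂ := by
  obtain ⟨f, hf, hfd⟩ := exists_increasing hp he
  obtain ⟨a, ha, hax, ha'⟩ := h₁.exists_cof_eq hθ₁
  obtain ⟨b, hb, hbx, hb'⟩ := h₂.exists_cof_eq hθ₂
  have : Nonempty (Node e) := ⟨(exists_root e).choose⟩
  rw [← ha', ← hb']
  exact (pairTree_isRich ht hA hB hP).cof_eq hκ hf hfd ha hb hax hbx

end PairTree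

/-- The product of two nontrivial orders, as an equivalence with definable graph. -/
theorem exists_prod {a b : s.Or} (ha : a.1.Nontrivial) (hb : b.1.Nontrivial) :
    ∃ e : s.Or, e.1.Nontrivial ∧ ∃ P : a.1.X × b.1.X ≃ e.1.X,
      DefPred s.Lp s.N (fun z : (a.1.X × b.1.X) × e.1.X => P z.1 = z.2) := by
  obtain ⟨e, he, ⟨P, hbij, hP⟩, hnt⟩ := s.prod a a.2 b b.2
  refine ⟨⟨e, he⟩, hnt ha hb, Equiv.ofBijective P hbij, ?_⟩
  have h : DefPred s.Lp s.N
      (fun z : a.1.X × b.1.X × e.X => P (z.1, z.2.1) = z.2.2) := by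
    have heq : {v : Fin a.1.φ.arity ⊕ Fin b.1.φ.arity ⊕ Fin e.φ.arity → s.N |
          ∃ (x : a.1.X) (y : b.1.X), v = Sum.elim x.1 (Sum.elim y.1 (P (x, y)).1)} =
        {v | ∃ z : a.1.X × b.1.X × e.X, P (z.1, z.2.1) = z.2.2 ∧ v = code (N := s.N) s.Lp z} := by
      ext v
      constructor
      · rintro ⟨x, y, rfl⟩
        exact ⟨(x, y, P (x, y)), rfl, rfl⟩
      · rintro ⟨⟨x, y, z⟩, hz, rfl⟩
        obtain rfl : P (x, y) = z := hz
        exact ⟨x, y, rfl⟩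
    rw [heq] at hP
    exact hP
  exact h.comp (f := fun z : (a.1.X × b.1.X) × e.X => (z.1.1, z.1.2, z.2))
    (IsCodedMap.id.fst.fst.prodMk (IsCodedMap.id.fst.snd.prodMk IsCodedMap.id.snd))

theorem cut_unique {κ θ₁ θ₂ : Cardinal.{u}} (hp : (κ : WithTop Cardinal) ≤ s.p)
    (ht : (κ : WithTop Cardinal) < s.t) (h₁ : (κ, θ₁) ∈ s.cutSpectrum)
    (h₂ : (κ, θ₂) ∈ s.cutSpectrum) : θ₁ = θ₂ := by
  obtain ⟨hκ, hθ₁, a, ha, h₁⟩ := mem_cutSpectrum_iff.1 h₁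
  obtain ⟨-, hθ₂, b, hb, h₂⟩ := mem_cutSpectrum_iff.1 h₂
  obtain ⟨e, he, P, hP⟩ := exists_prod ha hb
  exact hasGap_unique hp ht hκ he (defPred_le a) (defPred_le b) hP hθ₁ hθ₂ h₁ h₂

/-- A cut with left-hand length `κ` and a cut with right-hand length `κ` are mirror images. -/
theorem cut_symm {κ θ₁ θ₂ : Cardinal.{u}} (hp : (κ : WithTop Cardinal) ≤ s.p)
    (ht : (κ : WithTop Cardinal) < s.t) (h₁ : (κ, θ₁) ∈ s.cutSpectrum)
    (h₂ : (θ₂, κ) ∈ s.cutSpectrum) : θ₁ = θ₂ := by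
  obtain ⟨hκ, hθ₁, a, ha, h₁⟩ := mem_cutSpectrum_iff.1 h₁
  obtain ⟨hθ₂, -, b, hb, h₂⟩ := mem_cutSpectrum_iff.1 h₂
  obtain ⟨e, he, P, hP⟩ := exists_prod ha hb
  -- The pairing of `X_a × X_b` serves for `X_a × X_bᵒᵈ` as well, the underlying sets being equal.
  have hb' : DefPred s.Lp s.N (fun z : b.1.Xᵒᵈ × b.1.Xᵒᵈ => z.1 ≤ z.2) :=
    (defPred_le b).comp₂ (r := fun x y => x ≤ y) (X := b.1.X × b.1.X)
      IsCodedMap.id.snd IsCodedMap.id.fst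
  exact hasGap_unique (A := a.1.X) (B := b.1.Xᵒᵈ) (P := P) hp ht hκ he (defPred_le a) hb' hP
    hθ₁ hθ₂ h₁ h₂.dual

theorem exists_mem_cutSpectrum {κ : Cardinal.{u}} (hp : (κ : WithTop Cardinal) ≤ s.p)
    (hκ : κ.IsRegular) :
    (∃ θ, (κ, θ) ∈ s.cutSpectrum) ∧ ∃ θ, (θ, κ) ∈ s.cutSpectrum := by
  obtain ⟨a, ha, hnt, -⟩ := s.good_prod
  obtain ⟨θ₁, hθ₁, h₁⟩ := exists_hasGap hp hκ (a := ⟨a, ha⟩) hnt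
  obtain ⟨θ₂, hθ₂, h₂⟩ := exists_hasGap_dual hp hκ (a := ⟨a, ha⟩) hnt
  exact ⟨⟨θ₁, mem_cutSpectrum_iff.2 ⟨hκ, hθ₁, _, hnt, h₁⟩⟩,
    ⟨θ₂, mem_cutSpectrum_iff.2 ⟨hθ₂, hκ, _, hnt, h₂⟩⟩⟩

end CofinalitySpectrum.CSP

end Spectrum

theorem mainTheorem5 (s : CofinalitySpectrum.CSP) (κ : Cardinal) (hκ : κ.IsRegular)
    (hlt : (κ : WithTop Cardinal) < min (Order.succ s.p) s.t) :
    (∃! θ : Cardinal, (κ, θ) ∈ s.cutSpectrum) ∧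
      ∀ θ : Cardinal, (κ, θ) ∈ s.cutSpectrum ↔ (θ, κ) ∈ s.cutSpectrum := by
  have hp : (κ : WithTop Cardinal) ≤ s.p := Order.le_of_lt_succ (hlt.trans_le (min_le_left _ _))
  have ht : (κ : WithTop Cardinal) < s.t := hlt.trans_le (min_le_right _ _)
  obtain ⟨⟨θ₁, h₁⟩, θ₂, h₂⟩ := CofinalitySpectrum.CSP.exists_mem_cutSpectrum hp hκ
  refine ⟨⟨θ₁, h₁, fun θ h => CofinalitySpectrum.CSP.cut_unique hp ht h h₁⟩, fun θ => ⟨?_, ?_⟩⟩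
  · intro h
    rwa [CofinalitySpectrum.CSP.cut_symm hp ht h h₂]
  · intro h
    rwa [← CofinalitySpectrum.CSP.cut_symm hp ht h₁ h]
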